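/- Conventions. An ordered semigroup is a commutative monoid $S$ with a translation invariant partial order whose smallest element is $0$. For elements $s,t$ of a partially ordered set in which increasing sequences have suprema, write $s\ll t$ if for every increasing sequence $(t_n)_n$ with $t\le\sup_n t_n$ there is $n_0$ with $s\le t_{n_0}$. The axioms O1–O6 on $S$ are: - O1. Every increasing sequence in $S$ has a supremum. - O2. For every $s\in S$ there is a sequence $(s_n)$ with $s_n\ll s_{n+1}$ for all $n$ and $s=\sup_n s_n$. - O3. If $s_1\ll t_1$ and $s_2\ll t_2$, then $s_1+s_2\ll t_1+t_2$. - O4. If $(s_n)$ and $(t_n)$ are increasing, then $\sup_n(s_n+t_n)=\sup_n s_n+\sup_n t_n$. - O5. If $s'\ll s\le t$, then there is $r$ with $s'+r\le t\le s+r$. - O6. If $s\le r+t$ and $s'\ll s$, then there are $r',t'$ with $s'\le r'+t'$, $r'\le r$, $r'\le s$, $t'\le t$ and $t'\le s$. Let $\mathrm F(S)$ be the set of functionals on $S$, that is, of maps $\lambda\colon S\to[0,\infty]$ which preserve $0$, addition, the order and suprema of increasing sequences. For $s\in S$ put $\hat s(\lambda)=\lambda(s)$. Let $S_{\mathbb R}$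 be the set of functions $f\colon\mathrm F(S)\to[0,\infty]$ for which there are $s_i\in S$ and integers $n_i\ge 1$ ($i=1,2,\dots$) such that the sequence $(\hat s_i/n_i)_i$ is pointwise increasing and $f(\lambda)=\sup_i \hat s_i(\lambda)/n_i$ for all $\lambda\in \mathrm F(S)$. Equip $S_{\mathbb R}$ with pointwise addition and pointwise order; the relation $\ll$ between elements of $S_{\mathbb R}$ is taken in $S_{\mathbb R}$. Theorem 4.1. Let $S$ be an ordered semigroup satisfying O1–O6. Let $(f_i)_{i=1}^n$ and $(g_j)_{j=1}^m$ be elements of $S_{\mathbb R}$ such that $$\sum_{i=1}^n f_i\le\sum_{j=1}^m g_j ,$$ and let $(f_i')_{i=1}^n$ be elements of $S_{\mathbb R}$ such that $f_i'\ll f_i$ for all $i$. Then there exist elements $h_{i,j}\in S_{\mathbb R}$, $i=1,\dots,n$, $j=1,\dots,m$, such that $$f_i'\ll\sum_{j=1}^m h_{i,j}\ll f_i\quad\text{for all } i,\qquad \sum_{i=1}^n h_{i,j}\le g_j\quad\text{for all } j .$$ -/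

import Mathlib

open scoped ENNReal

/-- `s` is (sequentially) compactly contained in `t`, i.e. `s ≪ t`: whenever an increasing
sequence has a supremum `b` with `t ≤ b`, some term of the sequence is already above `s`. -/
def CompactlyContained {α : Type*} [Preorder α] (s t : α) : Prop :=
  ∀ (u : ℕ → α) (b : α), Monotone u → IsLUB (Set.range u) b → t ≤ b → ∃ n, s ≤ u n

/-- The axioms O1-O6 for a positive, abelian ordered semigroup `S` (a commutative monoid with a
translation invariant partial order whose smallest element is `0`). O1-O4 say that `S` is an
object of the category `Cu`, O5 is almost algebraic order, O6 is weak Riesz decomposition. -/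
structure CuAxioms (S : Type*) [AddCommMonoid S] [PartialOrder S] [IsOrderedAddMonoid S] :
    Prop where
  zero_le : ∀ s : S, 0 ≤ s
  O1 : ∀ u : ℕ → S, Monotone u → ∃ b, IsLUB (Set.range u) b
  O2 : ∀ s : S, ∃ u : ℕ → S,
    (∀ n, CompactlyContained (u n) (u (n + 1))) ∧ IsLUB (Set.range u) s
  O3 : ∀ s₁ s₂ t₁ t₂ : S, CompactlyContained s₁ t₁ → CompactlyContained s₂ t₂ →
    CompactlyContained (s₁ + s₂) (t₁ + t₂)
  O4 : ∀ (u v : ℕ → S) (a b : S), Monotone u → Monotone v →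
    IsLUB (Set.range u) a → IsLUB (Set.range v) b →
    IsLUB (Set.range fun n => u n + v n) (a + b)
  O5 : ∀ s' s t : S, CompactlyContained s' s → s ≤ t → ∃ r, s' + r ≤ t ∧ t ≤ s + r
  O6 : ∀ s r t : S, s ≤ r + t → ∀ s', CompactlyContained s' s →
    ∃ r' t', s' ≤ r' + t' ∧ r' ≤ r ∧ r' ≤ s ∧ t' ≤ t ∧ t' ≤ s

/-- The set `F(S)` of functionals on `S`: maps `S → [0,∞]` preserving `0`, addition, the order,
and suprema of increasing sequences. -/
structure CuFunctional (S : Type*) [AddCommMonoid S] [PartialOrder S] where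
  toFun : S → ℝ≥0∞
  map_zero : toFun 0 = 0
  map_add : ∀ s t, toFun (s + t) = toFun s + toFun t
  monotone : Monotone toFun
  map_sup : ∀ (u : ℕ → S) (b : S), Monotone u → IsLUB (Set.range u) b →
    toFun b = ⨆ n, toFun (u n)

/-- The function `ŝ` on `F(S)` induced by `s`, namely `ŝ(φ) = φ(s)`. -/
def CuFunctional.hat {S : Type*} [AddCommMonoid S] [PartialOrder S] (s : S) :
    CuFunctional S → ℝ≥0∞ :=
  fun φ => φ.toFun s

/-- The realification of `S`: the functions `F(S) → [0,∞]` that are the pointwise supremum of an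
increasing sequence `ŝ_i / n_i` with `s_i ∈ S` and `n_i` a positive integer, with pointwise
addition and pointwise order. Since every `ŝ` is linear and is lower semicontinuous for the
standard topology of `F(S)`, so is every such supremum; these two properties therefore need not be
demanded separately. -/
def CuRealification (S : Type*) [AddCommMonoid S] [PartialOrder S] :
    AddSubmonoid (CuFunctional S → ℝ≥0∞) where
  carrier := {f | ∃ (s : ℕ → S) (n : ℕ → ℕ), (∀ i, 0 < n i) ∧
    (Monotone fun i (φ : CuFunctional S) => CuFunctional.hat (s i) φ / (n i : ℝ≥0∞)) ∧
    ∀ φ, f φ = ⨆ i, CuFunctional.hat (s i) φ / (n i : ℝ≥0∞)}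
  zero_mem' := by
    refine ⟨fun _ => 0, fun _ => 1, fun _ => one_pos, fun _ _ _ => le_rfl, fun φ => ?_⟩
    simp [CuFunctional.hat, φ.map_zero]
  add_mem' := by
    rintro f g ⟨s, n, hn, hs, hf⟩ ⟨t, m, hm, ht, hg⟩
    have hsmul : ∀ (φ : CuFunctional S) (k : ℕ) (a : S),
        φ.toFun (k • a) = (k : ℝ≥0∞) * φ.toFun a := by
      intro φ k a
      induction k with
      | zero => simp [φ.map_zero]
      | succ k ih => rw [succ_nsmul, φ.map_add, ih]; push_cast; ring
    have key : ∀ i (φ : CuFunctional S),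
        CuFunctional.hat (m i • s i + n i • t i) φ / ((n i * m i : ℕ) : ℝ≥0∞)
          = CuFunctional.hat (s i) φ / (n i : ℝ≥0∞)
            + CuFunctional.hat (t i) φ / (m i : ℝ≥0∞) := by
      intro i φ
      have hn0 : (n i : ℝ≥0∞) ≠ 0 := by exact_mod_cast (hn i).ne'
      have hm0 : (m i : ℝ≥0∞) ≠ 0 := by exact_mod_cast (hm i).ne'
      simp only [CuFunctional.hat, φ.map_add, hsmul, Nat.cast_mul, ENNReal.add_div]
      congr 1
      · rw [mul_comm (n i : ℝ≥0∞)]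
        exact ENNReal.mul_div_mul_left _ _ hm0 (ENNReal.natCast_ne_top _)
      · exact ENNReal.mul_div_mul_left _ _ hn0 (ENNReal.natCast_ne_top _)
    refine ⟨fun i => m i • s i + n i • t i, fun i => n i * m i,
      fun i => Nat.mul_pos (hn i) (hm i), ?_, fun φ => ?_⟩
    · intro i j hij φ
      simp only [key]
      exact add_le_add (hs hij φ) (ht hij φ)
    · simp only [key, Pi.add_apply, hf, hg]
      exact ENNReal.iSup_add_iSup_of_monotone (fun i j hij => hs hij φ)
        (fun i j hij => ht hij φ)

/-! Elements of the realification can be multiplied by nonnegative reals, and finite values can be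
cancelled pointwise. These two features upgrade the weak decomposition axiom O6 to a genuine one.

Comparisons of functionals are first brought back to `S`. If `s' ≪ s` and `ŝ ≤ t̂`, then `p • s' ≤ q
• t` for some `p ≤ q` with `p / q` as close to one as desired (`exists_nsmul_le_nsmul`); otherwise a
Hahn–Banach type extension yields a functional separating `s` from `t`. Together with compactness of
the set of functionals (`exists_mul_hat_le`), this transfers O5 and O6 to the realification
(`exists_remainder`, `exists_le_add`).

For a single `f ≤ ∑ g j`, let `h j ≤ g j` capture a fraction `α` of `f`. Subtract the `h j` from the
`g j` and their sum from `f`, up to small gaps. The remainder `e` of `f` lies below the sum of the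
remainders `k j` plus a small error, and weak decomposition gives pieces `r j` below both `k j` and
`e`. The pieces may add up to more than `e`, but with `m` indices the pieces `r j / m` do not, so a
fraction `1 / m` of what was missing is gained (`HasDecomposition.improve`). Iteration brings `α`
arbitrarily close to one, and the slack in `f' ≪ f` covers the rest.

Several `f i` are treated by induction: decompose the first, cancel it, and decompose the others
inside the remainders; scaling down absorbs the cancellation error (`exists_refinement`). -/

open scoped NNReal

/-! ### Compact containment in an ordered semigroup. -/

namespace CompactlyContained

variable {α : Type*} [Preorder α]

theorem le {s t : α} (h : CompactlyContained s t) : s ≤ t := by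
  obtain ⟨_, hn⟩ := h (fun _ => t) t monotone_const (by simp [isLUB_singleton]) le_rfl
  exact hn

theorem mono {s s' t t' : α} (hs : s' ≤ s) (h : CompactlyContained s t) (ht : t ≤ t') :
    CompactlyContained s' t' := fun u b hu hb htb =>
  (h u b hu hb (ht.trans htb)).imp fun _ hn => hs.trans hn

end CompactlyContained

namespace CuAxioms

variable {S : Type*} [AddCommMonoid S] [PartialOrder S] [IsOrderedAddMonoid S]

theorem exists_seq (hS : CuAxioms S) (s : S) : ∃ u : ℕ → S, Monotone u ∧
    (∀ n, CompactlyContained (u n) (u (n + 1))) ∧ (∀ n, CompactlyContained (u n) s) ∧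
    IsLUB (Set.range u) s := by
  obtain ⟨u, hu, hs⟩ := hS.O2 s
  exact ⟨u, monotone_nat_of_le_succ fun n => (hu n).le, hu,
    fun n => (hu n).mono le_rfl (hs.1 ⟨n + 1, rfl⟩), hs⟩

theorem zero_compactlyContained (hS : CuAxioms S) (s : S) : CompactlyContained 0 s :=
  fun _ _ _ _ _ => ⟨0, hS.zero_le _⟩

theorem interpolate (hS : CuAxioms S) {s t : S} (h : CompactlyContained s t) :
    ∃ r, CompactlyContained s r ∧ CompactlyContained r t := by
  obtain ⟨u, hm, hu, hut, hl⟩ := hS.exists_seq t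
  obtain ⟨n, hn⟩ := h u t hm hl le_rfl
  exact ⟨u (n + 1), (hu n).mono hn le_rfl, hut _⟩

theorem nsmul_compactlyContained (hS : CuAxioms S) {s t : S} (h : CompactlyContained s t) (k : ℕ) :
    CompactlyContained (k • s) (k • t) := by
  induction k with
  | zero => simpa using hS.zero_compactlyContained (0 : S)
  | succ k ih => simpa only [succ_nsmul] using hS.O3 _ _ _ _ ih h

end CuAxioms

/-! ### Scaling and regularization of functionals. -/

namespace CuFunctional

variable {S : Type*} [AddCommMonoid S] [PartialOrder S]

theorem map_nsmul (φ : CuFunctional S) (k : ℕ) (a : S) :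
    φ.toFun (k • a) = (k : ℝ≥0∞) * φ.toFun a := by
  induction k with
  | zero => simp [φ.map_zero]
  | succ k ih => rw [succ_nsmul, φ.map_add, ih]; push_cast; ring

/-- The multiple of a functional by a scalar. -/
noncomputable def scale (c : ℝ≥0∞) (φ : CuFunctional S) : CuFunctional S where
  toFun s := c * φ.toFun s
  map_zero := by simp [φ.map_zero]
  map_add s t := by rw [φ.map_add, mul_add]
  monotone _ _ h := mul_le_mul_right (φ.monotone h) c
  map_sup u b hu hb := by rw [φ.map_sup u b hu hb, ENNReal.mul_iSup]

variable [IsOrderedAddMonoid S]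

/-- The functional obtained from an additive monotone map by making it preserve suprema. -/
noncomputable def regularize (hS : CuAxioms S) (l : S → ℝ≥0∞) (h0 : l 0 = 0)
    (hadd : ∀ s t, l (s + t) = l s + l t) (hmono : Monotone l) : CuFunctional S where
  toFun s := ⨆ r : {r : S // CompactlyContained r s}, l r
  map_zero := by
    refine le_antisymm (iSup_le fun r => ?_) bot_le
    rw [← h0]
    exact hmono r.2.le
  map_add s t := by
    -- Subadditivity comes from approximating both summands and O4, superadditivity from O3.
    refine le_antisymm (iSup_le fun r => ?_) ?_
    · obtain ⟨u, hu, -, hus, hs⟩ := hS.exists_seq s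
      obtain ⟨v, hv, -, hvt, ht⟩ := hS.exists_seq t
      obtain ⟨n, hn⟩ := r.2 _ _ (hu.add hv) (hS.O4 u v s t hu hv hs ht) le_rfl
      refine (hmono hn).trans ?_
      rw [hadd]
      exact add_le_add (le_iSup (fun r : {r : S // CompactlyContained r s} => l r) ⟨u n, hus n⟩)
        (le_iSup (fun r : {r : S // CompactlyContained r t} => l r) ⟨v n, hvt n⟩)
    · have : Nonempty {r : S // CompactlyContained r s} := ⟨0, hS.zero_compactlyContained s⟩
      have : Nonempty {r : S // CompactlyContained r t} := ⟨0, hS.zero_compactlyContained t⟩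
      refine ENNReal.iSup_add_iSup_le fun a b => ?_
      rw [← hadd]
      exact le_iSup (fun r : {r : S // CompactlyContained r (s + t)} => l r)
        ⟨a.1 + b.1, hS.O3 _ _ _ _ a.2 b.2⟩
  monotone s t h := iSup_le fun r =>
    le_iSup (fun r : {r : S // CompactlyContained r t} => l r) ⟨r.1, r.2.mono le_rfl h⟩
  map_sup u b hu hb := by
    refine le_antisymm (iSup_le fun r => ?_) (iSup_le fun n => iSup_le fun r => ?_)
    · obtain ⟨q, hrq, hqb⟩ := hS.interpolate r.2
      obtain ⟨n, hn⟩ := hqb u b hu hb le_rfl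
      exact le_iSup_of_le n (le_iSup (fun r : {r : S // CompactlyContained r (u n)} => l r)
        ⟨r.1, hrq.mono le_rfl hn⟩)
    · exact le_iSup (fun r : {r : S // CompactlyContained r b} => l r)
        ⟨r.1, r.2.mono le_rfl (hb.1 ⟨n, rfl⟩)⟩

theorem regularize_le (hS : CuAxioms S) (l : S → ℝ≥0∞) (h0 : l 0 = 0)
    (hadd : ∀ s t, l (s + t) = l s + l t) (hmono : Monotone l) (s : S) :
    (regularize hS l h0 hadd hmono).toFun s ≤ l s :=
  iSup_le fun r => hmono r.2.le

theorem le_regularize (hS : CuAxioms S) (l : S → ℝ≥0∞) (h0 : l 0 = 0)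
    (hadd : ∀ s t, l (s + t) = l s + l t) (hmono : Monotone l) {r s : S}
    (h : CompactlyContained r s) :
    l r ≤ (regularize hS l h0 hadd hmono).toFun s :=
  le_iSup (fun r : {r : S // CompactlyContained r s} => l r) ⟨r, h⟩

end CuFunctional

/-! ### Compactness of the set of functionals. -/

namespace CuRealification

variable {S : Type*} [AddCommMonoid S] [PartialOrder S]

theorem apply_scale {f : CuFunctional S → ℝ≥0∞} (hf : f ∈ CuRealification S) (c : ℝ≥0∞)
    (φ : CuFunctional S) : f (φ.scale c) = c * f φ := by
  obtain ⟨s, n, -, -, h⟩ := hf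
  rw [h, h, ENNReal.mul_iSup]
  simp only [CuFunctional.hat, CuFunctional.scale, mul_div_assoc]

/-- If `ŝ` lies below the supremum of an increasing sequence in the realification and `s' ≪ s`,
then every multiple of `ŝ'` by a factor less than one lies below a term of the sequence. -/
theorem exists_mul_hat_le [IsOrderedAddMonoid S] (hS : CuAxioms S) {s' s : S}
    (hs : CompactlyContained s' s) {c : ℝ≥0∞} (hc : c < 1)
    {u : ℕ → CuFunctional S → ℝ≥0∞} (hu : ∀ k, u k ∈ CuRealification S) (hum : Monotone u)
    (hsu : ∀ φ : CuFunctional S, φ.toFun s ≤ ⨆ k, u k φ) :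
    ∃ k, ∀ φ : CuFunctional S, c * φ.toFun s' ≤ u k φ := by
  by_contra! hcon
  -- Counterexamples are rescaled so that they cannot degenerate in the limit. If the value at `s'`
  -- is infinite, it stays so under any nonzero factor, which is then chosen to make `u k φ` small.
  have key : ∀ k, ∃ φ : CuFunctional S, 1 ≤ φ.toFun s' ∧ u k φ ≤ c := by
    intro k
    obtain ⟨φ, hφ⟩ := hcon k
    have hc0 : c ≠ 0 := by rintro rfl; simp at hφ
    have h0 : φ.toFun s' ≠ 0 := by intro h; simp [h] at hφ
    by_cases ht : φ.toFun s' = ∞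
    · have hfin : u k φ ≠ ∞ := hφ.ne_top
      obtain ⟨d, hd0, hd⟩ : ∃ d : ℝ≥0∞, d ≠ 0 ∧ d * u k φ ≤ c := by
        rcases eq_or_ne (u k φ) 0 with h | h
        · exact ⟨1, one_ne_zero, by simp [h]⟩
        · refine ⟨c / u k φ, ?_, (ENNReal.div_mul_cancel h hfin).le⟩
          exact (ENNReal.div_pos hc0 hfin).ne'
      refine ⟨φ.scale d, ?_, ?_⟩
      · simp [CuFunctional.scale, ht, ENNReal.mul_top hd0]
      · rwa [apply_scale (hu k)]
    · refine ⟨φ.scale (φ.toFun s')⁻¹, ?_, ?_⟩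
      · simp [CuFunctional.scale, ENNReal.inv_mul_cancel h0 ht]
      · rw [apply_scale (hu k), mul_comm, ← div_eq_mul_inv]
        exact ENNReal.div_le_of_le_mul hφ.le
  choose φ hφ1 hφc using key
  -- The limit along an ultrafilter is additive and monotone but need not preserve suprema;
  -- regularizing repairs this, at the cost of passing from `s'` to `s`.
  let U := Filter.hyperfilter ℕ
  let l : S → ℝ≥0∞ := fun x => (U.map fun k => (φ k).toFun x).lim
  have hl : ∀ x, Filter.Tendsto (fun k => (φ k).toFun x) U (nhds (l x)) := fun x =>
    (U.map fun k => (φ k).toFun x).le_nhds_lim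
  have h0 : l 0 = 0 := by
    refine tendsto_nhds_unique (hl 0) ?_
    simp only [CuFunctional.map_zero]
    exact tendsto_const_nhds
  have hadd : ∀ x y, l (x + y) = l x + l y := fun x y => by
    refine tendsto_nhds_unique (hl _) ?_
    simp only [CuFunctional.map_add]
    exact (hl x).add (hl y)
  have hmono : Monotone l := fun x y h =>
    le_of_tendsto_of_tendsto' (hl x) (hl y) fun k => (φ k).monotone h
  have h1 : 1 ≤ l s' := ge_of_tendsto' (hl s') hφ1
  -- The regularized limit is at least one at `s`. Regularizing only decreases values, and `u j ≤ u
  -- k` for `k ≥ j`, so every `u j` is at most `c` there.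
  refine absurd ((h1.trans (CuFunctional.le_regularize hS l h0 hadd hmono hs)).trans (hsu _))
    (not_le.mpr (lt_of_le_of_lt (iSup_le fun j => ?_) hc))
  obtain ⟨t, n, hn, -, ht⟩ := hu j
  rw [ht]
  refine iSup_le fun i => ?_
  have hn0 : (n i : ℝ≥0∞) ≠ 0 := by exact_mod_cast (hn i).ne'
  refine ENNReal.div_le_of_le_mul ((CuFunctional.regularize_le hS l h0 hadd hmono _).trans ?_)
  refine le_of_tendsto (hl (t i)) ?_
  have hev : ∀ᶠ k in (U : Filter ℕ), j ≤ k :=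
    Nat.hyperfilter_le_atTop (Filter.eventually_ge_atTop j)
  filter_upwards [hev] with k hk
  have h2 : CuFunctional.hat (t i) (φ k) / (n i : ℝ≥0∞) ≤ c := by
    refine le_trans ?_ ((hum hk (φ k)).trans (hφc k))
    rw [ht]
    exact le_iSup (fun i => CuFunctional.hat (t i) (φ k) / (n i : ℝ≥0∞)) i
  exact (ENNReal.div_le_iff hn0 (ENNReal.natCast_ne_top _)).mp h2

end CuRealification

/-! ### Comparison in `S` from comparison of functionals. -/

theorem ENNReal.le_of_forall_le_add_two_div {A B : ℝ≥0∞}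
    (h : ∀ c : ℕ, 0 < c → A ≤ B + 2 / (c : ℝ≥0∞)) : A ≤ B := by
  have h1 : Filter.Tendsto (fun c : ℕ => B + 2 / (c : ℝ≥0∞)) Filter.atTop (nhds (B + 0)) := by
    refine tendsto_const_nhds.add ?_
    simpa [div_eq_mul_inv] using
      ENNReal.Tendsto.const_mul (a := 2) ENNReal.tendsto_inv_nat_nhds_zero (Or.inr (by simp))
  rw [add_zero] at h1
  exact ge_of_tendsto h1 ((Filter.eventually_gt_atTop 0).mono h)

section Comparison

variable {S : Type*} [AddCommMonoid S] [PartialOrder S]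

/-- `x` lies in the order ideal generated by `t`. -/
def MultiplyBounded (t x : S) : Prop := ∃ k : ℕ, x ≤ k • t

theorem MultiplyBounded.of_le {t x y : S} (hy : MultiplyBounded t y) (h : x ≤ y) :
    MultiplyBounded t x :=
  hy.imp fun _ hk => h.trans hk

/-- An additive relation on `S`, containing the order, which never bounds a multiple of `t` by a
smaller multiple of `t`, even after adding an element of the ideal generated by `t`. -/
structure IsConsistent (t : S) (P : AddSubmonoid (S × S)) : Prop where
  of_le : ∀ {x y : S}, x ≤ y → (x, y) ∈ P
  le : ∀ {z : S} {a b : ℕ}, MultiplyBounded t z → (z + a • t, z + b • t) ∈ P → a ≤ b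

theorem not_isConsistent_sup {t : S} {P : AddSubmonoid (S × S)} (hP : ∀ {x y : S}, x ≤ y → (x, y) ∈ P)
    {w : S × S} (h : ¬ IsConsistent t (P ⊔ AddSubmonoid.closure {w})) :
    ∃ (z : S) (a b k : ℕ) (v : S × S), MultiplyBounded t z ∧ b < a ∧ v ∈ P ∧
      v + k • w = (z + a • t, z + b • t) := by
  by_contra! hc
  refine h ⟨fun hxy => (le_sup_left : P ≤ _) (hP hxy), fun {z a b} hz hm => ?_⟩
  obtain ⟨v, hv, w', hw', hvw⟩ := AddSubmonoid.mem_sup.mp hm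
  obtain ⟨k, rfl⟩ := AddSubmonoid.mem_closure_singleton.mp hw'
  by_contra! hab
  exact hc z a b k v hz hab hv hvw

theorem IsConsistent.exists_maximal {t : S} {P : AddSubmonoid (S × S)} (hP : IsConsistent t P) :
    ∃ Q, P ≤ Q ∧ Maximal (IsConsistent t) Q := by
  refine zorn_le_nonempty₀ {Q | IsConsistent t Q} (fun c hc hchain Q hQ => ?_) P hP
  refine ⟨sSup c, ⟨fun hxy => ?_, fun hz hm => ?_⟩, fun R hR => le_sSup hR⟩
  · exact le_sSup hQ ((hc hQ).of_le hxy)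
  · obtain ⟨R, hR, hm⟩ := (AddSubmonoid.mem_sSup_of_directedOn ⟨Q, hQ⟩ hchain.directedOn).mp hm
    exact (hc hR).le hz hm

namespace IsConsistent

variable {t : S} {P : AddSubmonoid (S × S)}

open Classical in
/-- The additive map with value at most one at `t` defined by a consistent relation. -/
noncomputable def state (t : S) (P : AddSubmonoid (S × S)) (x : S) : ℝ≥0∞ :=
  if MultiplyBounded t x then
    ⨅ w : {w : ℕ × ℕ // 0 < w.1 ∧ (w.1 • x, w.2 • t) ∈ P}, (w.1.2 : ℝ≥0∞) / (w.1.1 : ℝ≥0∞)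
  else ∞

theorem state_le {x : S} (hx : MultiplyBounded t x) {p q : ℕ} (hp : 0 < p)
    (h : (p • x, q • t) ∈ P) : state t P x ≤ (q : ℝ≥0∞) / p := by
  rw [state, if_pos hx]
  exact iInf_le (fun w : {w : ℕ × ℕ // 0 < w.1 ∧ (w.1 • x, w.2 • t) ∈ P} =>
    (w.1.2 : ℝ≥0∞) / (w.1.1 : ℝ≥0∞)) ⟨(p, q), hp, h⟩

theorem state_zero (hP : IsConsistent t P) : state t P 0 = 0 := by
  refine le_antisymm ?_ bot_le
  have := state_le (P := P) (t := t) (x := 0) ⟨0, by simp⟩ one_pos (q := 0)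
    (hP.of_le (by simp))
  simpa using this

end IsConsistent

variable [IsOrderedAddMonoid S]

theorem MultiplyBounded.add {t x y : S} (hx : MultiplyBounded t x) (hy : MultiplyBounded t y) :
    MultiplyBounded t (x + y) := by
  obtain ⟨k, hk⟩ := hx
  obtain ⟨l, hl⟩ := hy
  exact ⟨k + l, by rw [add_nsmul]; exact add_le_add hk hl⟩

theorem MultiplyBounded.nsmul {t x : S} (hx : MultiplyBounded t x) (n : ℕ) :
    MultiplyBounded t (n • x) := by
  obtain ⟨k, hk⟩ := hx
  exact ⟨n * k, by rw [mul_nsmul']; exact nsmul_le_nsmul_right hk n⟩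

/-- If neither pair can be added, each addition produces a violation, using `k` copies of `(x, y)`
and `l` copies of `(y, x)` respectively. Adding `l` times the first violation and `k` times the
second turns these copies into a multiple of `(x + y, x + y)`, which lies in `P` already, so `P`
itself is violated. -/
theorem IsConsistent.total {t : S} {P : AddSubmonoid (S × S)} (hP : Maximal (IsConsistent t) P)
    (x y : S) : (x, y) ∈ P ∨ (y, x) ∈ P := by
  have aux : ∀ w : S × S, w ∉ P → ¬ IsConsistent t (P ⊔ AddSubmonoid.closure {w}) := by
    intro w hw hcon
    refine hw (hP.2 hcon le_sup_left ?_)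
    exact (le_sup_right : AddSubmonoid.closure {w} ≤ _) (AddSubmonoid.subset_closure rfl)
  by_contra! h
  obtain ⟨z, a, b, k, v, hz, hab, hv, h1⟩ := not_isConsistent_sup hP.1.of_le (aux _ h.1)
  obtain ⟨z', a', b', l, v', hz', hab', hv', h2⟩ := not_isConsistent_sup hP.1.of_le (aux _ h.2)
  have hk : 0 < k := by
    rcases Nat.eq_zero_or_pos k with rfl | hk
    · simp only [zero_smul, add_zero] at h1
      exact absurd (hP.1.le hz (h1 ▸ hv)) (not_le.mpr hab)
    · exact hk
  have h3 : l • v + k • v' + (k * l) • (x + y, x + y) ∈ P :=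
    add_mem (add_mem (nsmul_mem hv l) (nsmul_mem hv' k)) (nsmul_mem (hP.1.of_le le_rfl) _)
  have h4 : l • v + k • v' + (k * l) • (x + y, x + y)
      = l • (v + k • (x, y)) + k • (v' + l • (y, x)) := by
    ext <;> simp only [Prod.fst_add, Prod.snd_add, Prod.smul_fst, Prod.smul_snd, nsmul_add,
      mul_nsmul x k l, mul_nsmul y k l, ← mul_nsmul'] <;> simp only [mul_comm l k] <;> abel
  rw [h4, h1, h2] at h3
  have h5 : l • (z + a • t, z + b • t) + k • (z' + a' • t, z' + b' • t)
      = ((l • z + k • z') + (l * a + k * a') • t, (l • z + k • z') + (l * b + k * b') • t) := by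
    ext <;> simp only [Prod.fst_add, Prod.snd_add, Prod.smul_fst, Prod.smul_snd, nsmul_add, add_nsmul,
      mul_nsmul'] <;> abel
  rw [h5] at h3
  have h6 := hP.1.le ((hz.nsmul l).add (hz'.nsmul k)) h3
  have h7 : l * b ≤ l * a := Nat.mul_le_mul_left l hab.le
  have h8 : k * b' < k * a' := Nat.mul_lt_mul_of_pos_left hab' hk
  omega

namespace IsConsistent

variable {t : S} {P : AddSubmonoid (S × S)}

/-- Transitivity through `x` and `y` without cancellation: after adding suitable multiples of the
three relations, the terms in `x` and `y` agree on both sides and play the role of the element `z`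
in the definition of consistency. -/
theorem mul_le_mul (hP : IsConsistent t P) {x y : S} (hxy : x ≤ y) (hy : MultiplyBounded t y)
    {a c p q : ℕ} (h1 : (a • t, c • x) ∈ P) (h2 : (p • y, q • t) ∈ P) : p * a ≤ c * q := by
  have h3 : p • (a • t, c • x) + (p * c) • (x, y) + c • (p • y, q • t) ∈ P :=
    add_mem (add_mem (nsmul_mem h1 _) (nsmul_mem (hP.of_le hxy) _)) (nsmul_mem h2 _)
  have h4 : p • (a • t, c • x) + (p * c) • (x, y) + c • (p • y, q • t)
      = (((p * c) • x + (c * p) • y) + (p * a) • t, ((p * c) • x + (c * p) • y) + (c * q) • t) := by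
    ext <;> simp only [Prod.fst_add, Prod.snd_add, Prod.smul_fst, Prod.smul_snd, ← mul_nsmul', mul_comm c p] <;>
      abel
  rw [h4] at h3
  exact hP.le (((hy.of_le hxy).nsmul _).add (hy.nsmul _)) h3

/-- By totality, the least multiple of `t` that dominates `c • x` also bounds it from below after
one `t` is removed. This pins the state at `x` down to within `1 / c`, which is how monotonicity and
additivity are proved. -/
theorem exists_approx (hS : CuAxioms S) (hP : Maximal (IsConsistent t) P) {x : S}
    (hx : MultiplyBounded t x) (c : ℕ) :
    ∃ a : ℕ, (a • t, c • x) ∈ P ∧ (c • x, (a + 1) • t) ∈ P := by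
  classical
  have hex : ∃ a : ℕ, (c • x, a • t) ∈ P := by
    obtain ⟨k, hk⟩ := hx.nsmul c
    exact ⟨k, hP.1.of_le hk⟩
  rcases Nat.eq_zero_or_pos (Nat.find hex) with h | h
  · refine ⟨0, hP.1.of_le ?_, ?_⟩
    · rw [zero_nsmul]; exact hS.zero_le _
    · have h1 := Nat.find_spec hex
      rw [h] at h1
      have h2 := add_mem h1 (hP.1.of_le (hS.zero_le t))
      simpa using h2
  · refine ⟨Nat.find hex - 1, ?_, ?_⟩
    · refine (IsConsistent.total hP _ _).resolve_left ?_
      exact Nat.find_min hex (by omega)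
    · rw [Nat.sub_add_cancel h]
      exact Nat.find_spec hex

theorem le_state (hP : IsConsistent t P) {x y : S} (hxy : x ≤ y) {a c : ℕ} (hc : 0 < c)
    (h : (a • t, c • x) ∈ P) : (a : ℝ≥0∞) / c ≤ state t P y := by
  by_cases hy : MultiplyBounded t y
  · rw [state, if_pos hy]
    refine le_iInf fun w => ?_
    obtain ⟨⟨p, q⟩, hp, hw⟩ := w
    have h1 := hP.mul_le_mul hxy hy h hw
    have hp0 : (p : ℝ≥0∞) ≠ 0 := by exact_mod_cast hp.ne'
    have hc0 : (c : ℝ≥0∞) ≠ 0 := by exact_mod_cast hc.ne'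
    simp only at h1 ⊢
    refine ENNReal.div_le_of_le_mul ?_
    rw [div_eq_mul_inv, mul_right_comm, ← div_eq_mul_inv,
      ENNReal.le_div_iff_mul_le (Or.inl hp0) (Or.inl (ENNReal.natCast_ne_top _))]
    norm_cast
    linarith [mul_comm p a, mul_comm c q]
  · rw [state, if_neg hy]
    exact le_top

theorem state_mono (hS : CuAxioms S) (hP : Maximal (IsConsistent t) P) :
    Monotone (state t P) := by
  intro x y hxy
  by_cases hy : MultiplyBounded t y
  · refine ENNReal.le_of_forall_le_add_two_div fun c hc => ?_
    obtain ⟨a, h1, h2⟩ := exists_approx hS hP (hy.of_le hxy) c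
    calc state t P x ≤ ((a + 1 : ℕ) : ℝ≥0∞) / c := state_le (hy.of_le hxy) hc h2
      _ = (a : ℝ≥0∞) / c + 1 / c := by rw [Nat.cast_add, ENNReal.add_div, Nat.cast_one]
      _ ≤ _ := add_le_add (le_state hP.1 hxy hc h1) (ENNReal.div_le_div_right one_le_two _)
  · rw [state, state, if_neg hy]
    exact le_top

theorem state_add (hS : CuAxioms S) (hP : Maximal (IsConsistent t) P) (x y : S) :
    state t P (x + y) = state t P x + state t P y := by
  by_cases hx : MultiplyBounded t x
  swap
  · have : ¬ MultiplyBounded t (x + y) := fun h => hx (h.of_le (by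
      simpa using add_le_add_right (hS.zero_le y) x))
    simp [state, hx, this]
  by_cases hy : MultiplyBounded t y
  swap
  · have : ¬ MultiplyBounded t (x + y) := fun h => hy (h.of_le (by
      simpa using add_le_add_left (hS.zero_le x) y))
    simp [state, hy, this]
  have key : ∀ c : ℕ, 0 < c → ∃ A : ℝ≥0∞, A ≤ state t P (x + y) ∧ A ≤ state t P x + state t P y ∧
      state t P (x + y) ≤ A + 2 / c ∧ state t P x + state t P y ≤ A + 2 / c := by
    intro c hc
    obtain ⟨a, h1, h2⟩ := exists_approx hS hP hx c
    obtain ⟨b, h3, h4⟩ := exists_approx hS hP hy c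
    have h5 : ((a + b) • t, c • (x + y)) ∈ P := by
      simpa [add_nsmul, nsmul_add] using add_mem h1 h3
    have h6 : (c • (x + y), (a + 1 + (b + 1)) • t) ∈ P := by
      rw [add_nsmul _ (a + 1), nsmul_add]
      exact add_mem h2 h4
    refine ⟨((a + b : ℕ) : ℝ≥0∞) / c, le_state hP.1 le_rfl hc h5, ?_, ?_, ?_⟩
    · rw [Nat.cast_add, ENNReal.add_div]
      exact add_le_add (le_state hP.1 le_rfl hc h1) (le_state hP.1 le_rfl hc h3)
    · refine (state_le (hx.add hy) hc h6).trans_eq ?_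
      rw [← ENNReal.add_div]
      congr 1
      push_cast
      ring
    · refine (add_le_add (state_le hx hc h2) (state_le hy hc h4)).trans_eq ?_
      rw [← ENNReal.add_div, ← ENNReal.add_div]
      congr 1
      push_cast
      ring
  refine le_antisymm (ENNReal.le_of_forall_le_add_two_div fun c hc => ?_)
    (ENNReal.le_of_forall_le_add_two_div fun c hc => ?_)
  · obtain ⟨A, -, h2, h3, -⟩ := key c hc
    exact h3.trans (by gcongr)
  · obtain ⟨A, h1, -, -, h4⟩ := key c hc
    exact h4.trans (by gcongr)

end IsConsistent

theorem add_nsmul_le_add_nsmul_of_add_le_add {z x y : S} (h : z + x ≤ z + y) (n : ℕ) :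
    z + n • x ≤ z + n • y := by
  induction n with
  | zero => simp
  | succ n ih =>
    calc z + (n + 1) • x = (z + n • x) + x := by rw [succ_nsmul]; abel
      _ ≤ (z + n • y) + x := by gcongr
      _ = (z + x) + n • y := by abel
      _ ≤ (z + y) + n • y := by gcongr
      _ = z + (n + 1) • y := by rw [succ_nsmul]; abel

/-- A violation reads `w + (t + k • p₀ • s) ≤ w + k • q₀ • t` with `w` in the ideal of `t`.
Iterating makes the contribution of `w` negligible, and the gained copies of `t`, bounded below
through `s ≤ d • t`, produce one of the excluded inequalities. -/
theorem isConsistent_of_forall_not_le (hS : CuAxioms S) {s t : S} (hst : MultiplyBounded t s)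
    {p₀ q₀ : ℕ} (hpq : p₀ ≤ q₀) (h : ∀ p q : ℕ, 0 < p → p • s ≤ q • t → ¬ p₀ * q ≤ q₀ * p) :
    ∃ P, IsConsistent t P ∧ (q₀ • t, p₀ • s) ∈ P := by
  let P₀ : AddSubmonoid (S × S) :=
    { carrier := {w | w.1 ≤ w.2}
      zero_mem' := le_rfl
      add_mem' := fun {a b} (ha : a.1 ≤ a.2) (hb : b.1 ≤ b.2) => add_le_add ha hb }
  refine ⟨P₀ ⊔ AddSubmonoid.closure {(q₀ • t, p₀ • s)}, ?_,
    (le_sup_right : AddSubmonoid.closure _ ≤ _) (AddSubmonoid.subset_closure rfl)⟩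
  by_contra hc
  obtain ⟨z, a, b, k, ⟨u, v⟩, ⟨e, hz⟩, hab, huv, heq⟩ :=
    not_isConsistent_sup (P := P₀) (fun hxy => hxy) hc
  obtain ⟨d, hd⟩ := hst
  change u ≤ v at huv
  have e1 : u + k • q₀ • t = z + a • t := congrArg Prod.fst heq
  have e2 : v + k • p₀ • s = z + b • t := congrArg Prod.snd heq
  have h1 : (z + b • t) + (t + k • p₀ • s) ≤ (z + b • t) + k • q₀ • t := by
    calc (z + b • t) + (t + k • p₀ • s) = z + (b + 1) • t + k • p₀ • s := by
          rw [succ_nsmul]; abel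
      _ ≤ z + a • t + k • p₀ • s := by
          gcongr
          · exact hS.zero_le t
          · exact hab
      _ = u + k • q₀ • t + k • p₀ • s := by rw [e1]
      _ ≤ v + k • q₀ • t + k • p₀ • s := by gcongr
      _ = (v + k • p₀ • s) + k • q₀ • t := by abel
      _ = _ := by rw [e2]
  -- Large enough for the `N` gained copies of `t` to outweigh `z + b • t ≤ (e + b) • t`, also after
  -- multiplication by `d`.
  set N := d * (e + b) + 1 with hN
  have h2 := add_nsmul_le_add_nsmul_of_add_le_add h1 N
  have h3 : N • (t + k • p₀ • s) ≤ (e + b + N * (k * q₀)) • t := by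
    calc N • (t + k • p₀ • s) ≤ (z + b • t) + N • (t + k • p₀ • s) := by
          refine le_add_of_nonneg_left (add_nonneg (hS.zero_le _) (hS.zero_le _))
      _ ≤ (z + b • t) + N • k • q₀ • t := h2
      _ ≤ (e • t + b • t) + N • k • q₀ • t := by gcongr
      _ = _ := by simp only [add_nsmul, mul_nsmul']
  refine h (N + d * (N * (k * p₀))) (d * (e + b + N * (k * q₀))) (by omega) ?_ ?_
  · calc (N + d * (N * (k * p₀))) • s = N • s + d • N • k • p₀ • s := by
          simp only [add_nsmul, mul_nsmul']
      _ ≤ N • d • t + d • N • k • p₀ • s := by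
          gcongr
      _ = d • N • (t + k • p₀ • s) := by
          simp only [nsmul_add]
          rw [nsmul_left_comm t N d]
      _ ≤ d • (e + b + N * (k * q₀)) • t := nsmul_le_nsmul_right h3 d
      _ = _ := by rw [mul_nsmul']
  · have h4 : p₀ * (d * (e + b)) ≤ q₀ * N := Nat.mul_le_mul hpq (by omega)
    calc p₀ * (d * (e + b + N * (k * q₀)))
        = p₀ * (d * (e + b)) + q₀ * (d * (N * (k * p₀))) := by ring
      _ ≤ q₀ * N + q₀ * (d * (N * (k * p₀))) := by gcongr
      _ = _ := by ring

/-- A comparison of functionals lifts, up to a factor close to one, to a comparison in `S`. -/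
theorem exists_nsmul_le_nsmul (hS : CuAxioms S) {s' s t : S} (hs : CompactlyContained s' s)
    (hst : ∀ φ : CuFunctional S, φ.toFun s ≤ φ.toFun t) {p₀ q₀ : ℕ} (hpq : p₀ < q₀) :
    ∃ p q : ℕ, 0 < p ∧ p ≤ q ∧ p₀ * q ≤ q₀ * p ∧ p • s' ≤ q • t := by
  suffices H : ∃ p q : ℕ, 0 < p ∧ p₀ * q ≤ q₀ * p ∧ p • s' ≤ q • t by
    obtain ⟨p, q, hp, h1, h2⟩ := H
    rcases le_total p q with h | h
    · exact ⟨p, q, hp, h, h1, h2⟩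
    · refine ⟨p, p, hp, le_rfl, Nat.mul_le_mul_right _ hpq.le, h2.trans ?_⟩
      exact nsmul_le_nsmul_left (hS.zero_le t) h
  by_contra! hcon
  by_cases hb : MultiplyBounded t s'
  · obtain ⟨P₁, hP₁, hmem⟩ := isConsistent_of_forall_not_le hS hb hpq.le
      (fun p q hp h h' => hcon p q hp h' h)
    obtain ⟨P, hle, hP⟩ := hP₁.exists_maximal
    have h0 := IsConsistent.state_zero hP.1
    have hadd := IsConsistent.state_add hS hP
    have hmono := IsConsistent.state_mono hS hP
    have h1 : IsConsistent.state t P t ≤ 1 := by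
      simpa using IsConsistent.state_le (P := P) (t := t) (x := t) ⟨1, by simp⟩ one_pos (q := 1)
        (hP.1.of_le le_rfl)
    have hp0 : 0 < p₀ := by
      rcases Nat.eq_zero_or_pos p₀ with rfl | h
      · obtain ⟨d, hd⟩ := hb
        exact absurd (by simpa using hd) (hcon 1 d one_pos (by simp))
      · exact h
    -- The state is at least `q₀ / p₀ > 1` at `s'` and at most one at `t`; regularizing gives a
    -- functional larger at `s` than at `t`.
    have h2 := IsConsistent.le_state hP.1 le_rfl hp0 (hle hmem)
    have h3 : 1 < (q₀ : ℝ≥0∞) / p₀ := by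
      rw [ENNReal.lt_div_iff_mul_lt (Or.inl (by exact_mod_cast hp0.ne'))
        (Or.inl (ENNReal.natCast_ne_top _)), one_mul]
      exact_mod_cast hpq
    have h4 := hst (CuFunctional.regularize hS _ h0 hadd hmono)
    exact absurd ((h2.trans (CuFunctional.le_regularize hS _ h0 hadd hmono hs)).trans
      (h4.trans ((CuFunctional.regularize_le hS _ h0 hadd hmono t).trans h1))) (not_le.mpr h3)
  · classical
    -- Outside the ideal of `t`, the separating functional is the one which vanishes exactly on that
    -- ideal.
    let l : S → ℝ≥0∞ := fun x => if MultiplyBounded t x then 0 else ∞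
    have h0 : l 0 = 0 := if_pos ⟨0, by simp⟩
    have hmono : Monotone l := by
      intro x y hxy
      by_cases hy : MultiplyBounded t y
      · simp [l, hy, hy.of_le hxy]
      · simp [l, hy]
    have hadd : ∀ x y, l (x + y) = l x + l y := by
      intro x y
      by_cases hx : MultiplyBounded t x
      · by_cases hy : MultiplyBounded t y
        · simp [l, hx, hy, hx.add hy]
        · have : ¬ MultiplyBounded t (x + y) := fun h =>
            hy (h.of_le (le_add_of_nonneg_left (hS.zero_le _)))
          simp [l, hy, this]
      · have : ¬ MultiplyBounded t (x + y) := fun h =>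
          hx (h.of_le (le_add_of_nonneg_right (hS.zero_le _)))
        simp [l, hx, this]
    have h1 : l t = 0 := if_pos ⟨1, by simp⟩
    have h2 : l s' = ∞ := if_neg hb
    have h4 := hst (CuFunctional.regularize hS _ h0 hadd hmono)
    have h5 := (CuFunctional.le_regularize hS _ h0 hadd hmono hs).trans
      (h4.trans (CuFunctional.regularize_le hS _ h0 hadd hmono t))
    rw [h1, h2] at h5
    simp at h5

end Comparison

/-! ### The elements `ŝ / n`, approximation and suprema in the realification. -/

namespace CuRealification

section Basic

variable {S : Type*} [AddCommMonoid S] [PartialOrder S]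

/-- The function `ŝ / n` on functionals. -/
noncomputable def basic (s : S) (n : ℕ) : CuFunctional S → ℝ≥0∞ := fun φ => φ.toFun s / (n : ℝ≥0∞)

theorem basic_mem (s : S) {n : ℕ} (hn : 0 < n) : basic s n ∈ CuRealification S :=
  ⟨fun _ => s, fun _ => n, fun _ => hn, monotone_const, fun φ => by
    simp [basic, CuFunctional.hat]⟩

theorem basic_mono {s t : S} (h : s ≤ t) (n : ℕ) : basic s n ≤ basic t n := fun φ =>
  ENNReal.div_le_div_right (φ.monotone h) _

theorem basic_add (s t : S) (n : ℕ) : basic (s + t) n = basic s n + basic t n := by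
  funext φ
  simp [basic, φ.map_add, ENNReal.add_div]

theorem basic_nsmul_mul (s : S) {k : ℕ} (hk : 0 < k) (n : ℕ) :
    basic (k • s) (k * n) = basic s n := by
  funext φ
  simp only [basic, φ.map_nsmul, Nat.cast_mul]
  exact ENNReal.mul_div_mul_left _ _ (by exact_mod_cast hk.ne') (ENNReal.natCast_ne_top _)

theorem basic_le_basic_iff {s t : S} {n m : ℕ} (hn : 0 < n) (hm : 0 < m) :
    basic s n ≤ basic t m ↔ ∀ φ : CuFunctional S, φ.toFun (m • s) ≤ φ.toFun (n • t) := by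
  have hn0 : (n : ℝ≥0∞) ≠ 0 := by exact_mod_cast hn.ne'
  have hm0 : (m : ℝ≥0∞) ≠ 0 := by exact_mod_cast hm.ne'
  refine forall_congr' fun φ => ?_
  rw [φ.map_nsmul, φ.map_nsmul, basic, basic,
    ENNReal.div_le_iff_le_mul (Or.inl hn0) (Or.inl (ENNReal.natCast_ne_top _)),
    div_eq_mul_inv, mul_right_comm, ← div_eq_mul_inv,
    ENNReal.le_div_iff_mul_le (Or.inl hm0) (Or.inl (ENNReal.natCast_ne_top _)),
    mul_comm (m : ℝ≥0∞), mul_comm (n : ℝ≥0∞)]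

theorem basic_nsmul_le_basic_nsmul (s : S) {a b c d : ℕ} (hb : 0 < b) (hd : 0 < d)
    (h : a * d ≤ c * b) : basic (a • s) b ≤ basic (c • s) d := by
  rw [basic_le_basic_iff hb hd]
  intro φ
  simp only [φ.map_nsmul, ← mul_assoc]
  refine mul_le_mul' ?_ le_rfl
  norm_cast
  linarith [mul_comm a d, mul_comm c b]

theorem basic_add_basic (s t : S) {n m : ℕ} (hn : 0 < n) (hm : 0 < m) :
    basic s n + basic t m = basic (m • s + n • t) (n * m) := by
  rw [basic_add, basic_nsmul_mul t hn, mul_comm n m, basic_nsmul_mul s hm]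

/-- The compact containment relation of the realification, for functions on the functionals. -/
def WayBelow (f g : CuFunctional S → ℝ≥0∞) : Prop :=
  ∀ u : ℕ → CuFunctional S → ℝ≥0∞, (∀ k, u k ∈ CuRealification S) → Monotone u →
    g ≤ ⨆ k, u k → ∃ k, f ≤ u k

namespace WayBelow

theorem mono {f f' g g' : CuFunctional S → ℝ≥0∞} (hf : f' ≤ f) (h : WayBelow f g) (hg : g ≤ g') :
    WayBelow f' g' := fun u hu hm hgu =>
  (h u hu hm (hg.trans hgu)).imp fun _ hk => hf.trans hk

theorem le {f g : CuFunctional S → ℝ≥0∞} (hg : g ∈ CuRealification S) (h : WayBelow f g) :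
    f ≤ g := by
  obtain ⟨_, hk⟩ := h (fun _ => g) (fun _ => hg) monotone_const (by simp)
  exact hk

end WayBelow

theorem nsmul_apply (k : ℕ) (f : CuFunctional S → ℝ≥0∞) (φ : CuFunctional S) :
    (k • f) φ = (k : ℝ≥0∞) * f φ := by
  rw [Pi.smul_apply, nsmul_eq_mul]

/-- The factor `p / q < 1` is needed even if `s ≪ s`, since `ŝ` is a supremum of smaller multiples
of itself. -/
theorem basic_wayBelow [IsOrderedAddMonoid S] (hS : CuAxioms S) {s' s : S}
    (h : CompactlyContained s' s) {n p q : ℕ} (hn : 0 < n) (hpq : p < q) :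
    WayBelow (basic (p • s') (q * n)) (basic s n) := by
  intro u hu hm hsu
  have hn0 : (n : ℝ≥0∞) ≠ 0 := by exact_mod_cast hn.ne'
  have hq0 : (q : ℝ≥0∞) ≠ 0 := by exact_mod_cast (Nat.zero_lt_of_lt hpq).ne'
  have hc : (p : ℝ≥0∞) / q < 1 := by
    rw [ENNReal.div_lt_iff (Or.inl hq0) (Or.inl (ENNReal.natCast_ne_top _)), one_mul]
    exact_mod_cast hpq
  obtain ⟨k, hk⟩ := exists_mul_hat_le hS h hc (u := fun k => n • u k)
    (fun k => nsmul_mem (hu k) n) (fun i j hij => nsmul_le_nsmul_right (hm hij) n) (fun φ => by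
      simp only [nsmul_apply, ← ENNReal.mul_iSup]
      have := hsu φ
      rw [iSup_apply, basic, ENNReal.div_le_iff hn0 (ENNReal.natCast_ne_top _)] at this
      rwa [mul_comm])
  refine ⟨k, fun φ => ?_⟩
  have h1 := hk φ
  rw [nsmul_apply] at h1
  rw [basic, φ.map_nsmul, Nat.cast_mul]
  refine ENNReal.div_le_of_le_mul ?_
  calc (p : ℝ≥0∞) * φ.toFun s' = q * (p / q * φ.toFun s') := by
        rw [← mul_assoc, ENNReal.mul_div_cancel hq0 (ENNReal.natCast_ne_top _)]
    _ ≤ q * (n * u k φ) := by gcongr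
    _ = _ := by ring

theorem iSup_natCast_div_add_one :
    ⨆ k : ℕ, ((k + 1 : ℕ) : ℝ≥0∞) / ((k + 2 : ℕ) : ℝ≥0∞) = 1 := by
  refine le_antisymm (iSup_le fun k => ?_) (ENNReal.le_of_forall_le_add_two_div fun c hc => ?_)
  · refine ENNReal.div_le_of_le_mul ?_
    rw [one_mul]
    exact_mod_cast Nat.le_succ _
  · refine le_trans ?_ (add_le_add (le_iSup (fun k : ℕ =>
      ((k + 1 : ℕ) : ℝ≥0∞) / ((k + 2 : ℕ) : ℝ≥0∞)) c) le_rfl)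
    have h2 : ((c + 2 : ℕ) : ℝ≥0∞) ≠ 0 := by exact_mod_cast (by omega : c + 2 ≠ 0)
    calc (1 : ℝ≥0∞) = ((c + 2 : ℕ) : ℝ≥0∞) / ((c + 2 : ℕ) : ℝ≥0∞) :=
          (ENNReal.div_self h2 (ENNReal.natCast_ne_top _)).symm
      _ = ((c + 1 : ℕ) : ℝ≥0∞) / ((c + 2 : ℕ) : ℝ≥0∞) + 1 / ((c + 2 : ℕ) : ℝ≥0∞) := by
          rw [← ENNReal.add_div]
          congr 1
          push_cast
          ring
      _ ≤ _ := by
          gcongr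
          · exact one_le_two
          · omega

theorem monotone_natCast_div_add_one :
    Monotone fun k : ℕ => ((k + 1 : ℕ) : ℝ≥0∞) / ((k + 2 : ℕ) : ℝ≥0∞) := by
  refine monotone_nat_of_le_succ fun k => ?_
  have h2 : ((k + 2 : ℕ) : ℝ≥0∞) ≠ 0 := by exact_mod_cast (by omega : k + 2 ≠ 0)
  have h3 : ((k + 1 + 2 : ℕ) : ℝ≥0∞) ≠ 0 := by exact_mod_cast (by omega : k + 1 + 2 ≠ 0)
  rw [ENNReal.div_le_iff h2 (ENNReal.natCast_ne_top _), div_eq_mul_inv, mul_right_comm,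
    ← div_eq_mul_inv, ENNReal.le_div_iff_mul_le (Or.inl h3) (Or.inl (ENNReal.natCast_ne_top _))]
  norm_cast
  nlinarith

theorem iSup_natCast_div_mul {v : ℕ → ℝ≥0∞} (hv : Monotone v) :
    ⨆ k : ℕ, ((k + 1 : ℕ) : ℝ≥0∞) / ((k + 2 : ℕ) : ℝ≥0∞) * v k = ⨆ k, v k := by
  refine le_antisymm (iSup_mono fun k => ?_) ?_
  · refine mul_le_of_le_one_left bot_le ?_
    rw [← iSup_natCast_div_add_one]
    exact le_iSup (fun k : ℕ => ((k + 1 : ℕ) : ℝ≥0∞) / ((k + 2 : ℕ) : ℝ≥0∞)) k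
  · refine iSup_le fun j => ?_
    rw [← one_mul (v j), ← iSup_natCast_div_add_one, ENNReal.iSup_mul]
    refine iSup_le fun i => le_iSup_of_le (max i j) ?_
    exact mul_le_mul' (monotone_natCast_div_add_one (le_max_left i j)) (hv (le_max_right i j))

theorem iSup_basic_nsmul {u : ℕ → S} {s : S} (hu : Monotone u) (hl : IsLUB (Set.range u) s)
    (n : ℕ) : ⨆ k, basic ((k + 1) • u k) ((k + 2) * n) = basic s n := by
  funext φ
  rw [iSup_apply, basic, φ.map_sup u s hu hl, ENNReal.iSup_div,
    ← iSup_natCast_div_mul fun i j hij => ENNReal.div_le_div_right (φ.monotone (hu hij)) _]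
  congr 1
  funext k
  rw [basic, φ.map_nsmul, Nat.cast_mul, div_eq_mul_inv, div_eq_mul_inv, div_eq_mul_inv,
    ENNReal.mul_inv (Or.inr (ENNReal.natCast_ne_top _)) (Or.inl (ENNReal.natCast_ne_top _))]
  ring

/-- The diagonal argument showing that iterated suprema reduce to a single supremum. -/
theorem exists_diagonal {b : ℕ → ℕ → CuFunctional S → ℝ≥0∞}
    (hb : ∀ i k, b i k ∈ CuRealification S) (hm : ∀ i, Monotone (b i))
    (hw : ∀ i k, WayBelow (b i k) (b i (k + 1))) (hf : Monotone fun i => ⨆ k, b i k) :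
    ∃ M : ℕ → ℕ, (∀ N, WayBelow (b N (M N)) (b (N + 1) (M (N + 1)))) ∧
      ⨆ N, b N (M N) = ⨆ i, ⨆ k, b i k := by
  -- The index `N` makes the diagonal eventually pass every `b i k`; the index `m + 1` makes
  -- consecutive diagonal terms compactly contained.
  have key : ∀ N m : ℕ, ∃ m', ∀ i ≤ N, b i (max N (m + 1)) ≤ b (N + 1) m' := by
    intro N m
    have h1 : ∀ i : Fin (N + 1), ∃ m', b i (max N (m + 1)) ≤ b (N + 1) m' := fun i =>
      hw i _ _ (hb _) (hm _)
        ((le_iSup (b i) _).trans (hf (show (i : ℕ) ≤ N + 1 from i.2.le)))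
    choose m' hm' using h1
    obtain ⟨K, hK⟩ := Finite.exists_le m'
    exact ⟨K, fun i hi => (hm' ⟨i, by omega⟩).trans (hm _ (hK _))⟩
  choose F hF using key
  let M : ℕ → ℕ := fun N => Nat.rec 0 (fun N m => F N m) N
  have hM : ∀ N, ∀ i ≤ N, b i (max N (M N + 1)) ≤ b (N + 1) (M (N + 1)) := fun N => hF N (M N)
  refine ⟨M, fun N => (hw N (M N)).mono le_rfl ?_, le_antisymm ?_ ?_⟩
  · exact (hm N (le_max_right _ _)).trans (hM N N le_rfl)
  · exact iSup_le fun N => le_iSup_of_le N (le_iSup (b N) _)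
  · refine iSup_le fun i => iSup_le fun k => le_iSup_of_le (max i k + 1) ?_
    refine le_trans (hm i ?_) (hM (max i k) i (le_max_left _ _))
    exact (le_max_right i k).trans (le_max_left _ _)

variable [IsOrderedAddMonoid S]

theorem monotone_basic_nsmul {u : ℕ → S} (hu : Monotone u) {n : ℕ} (hn : 0 < n) :
    Monotone fun k => basic ((k + 1) • u k) ((k + 2) * n) := by
  refine monotone_nat_of_le_succ fun k => ?_
  refine (basic_mono (nsmul_le_nsmul_right (hu k.le_succ) _) _).trans ?_
  refine basic_nsmul_le_basic_nsmul _ (by positivity) (by positivity) ?_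
  nlinarith

/-- Each `ŝ / n` is approximated by combining `u k ≪ u (k + 1)` in `S` with the increasing factors
`(k + 1) / (k + 2)`; a diagonal sequence then serves for `f`. -/
theorem exists_basic_seq (hS : CuAxioms S) {f : CuFunctional S → ℝ≥0∞}
    (hf : f ∈ CuRealification S) : ∃ (s : ℕ → S) (n : ℕ → ℕ), (∀ k, 0 < n k) ∧
      (∀ k, WayBelow (basic (s k) (n k)) (basic (s (k + 1)) (n (k + 1)))) ∧
      f = ⨆ k, basic (s k) (n k) := by
  obtain ⟨s, n, hn, hm, h⟩ := hf
  choose u hu huw _ hul using fun i => hS.exists_seq (s i)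
  have hsup := fun i => iSup_basic_nsmul (hu i) (hul i) (n i)
  obtain ⟨M, hM, he⟩ := exists_diagonal
    (b := fun i k => basic ((k + 1) • u i k) ((k + 2) * n i))
    (fun i k => basic_mem _ (Nat.mul_pos (by omega) (hn i)))
    (fun i => monotone_basic_nsmul (hu i) (hn i))
    (fun i k => by
      -- The ratio of consecutive factors is `(k + 1)(k + 3) / (k + 2) ^ 2 < 1`; the other multiples
      -- bring everything to a common denominator.
      have h1 := basic_wayBelow hS (hS.nsmul_compactlyContained (huw i k) ((k + 2) * (k + 3)))
        (n := (k + 3) * ((k + 3) * n i)) (p := (k + 1) * (k + 3)) (q := (k + 2) * (k + 2))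
        (Nat.mul_pos (by omega) (Nat.mul_pos (by omega) (hn i))) (by nlinarith)
      have := hn i
      refine h1.mono ?_ ?_
      · rw [← mul_nsmul']
        refine basic_nsmul_le_basic_nsmul _ (by positivity) (by positivity) (le_of_eq ?_)
        ring
      · refine basic_nsmul_le_basic_nsmul _ (by positivity) (by positivity) (le_of_eq ?_)
        ring)
    (by
      simp only [hsup]
      exact hm)
  refine ⟨_, _, fun k => ?_, hM, ?_⟩
  · exact Nat.mul_pos (by omega) (hn k)
  · rw [he]
    simp only [hsup]
    funext φ
    rw [h, iSup_apply]
    rfl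

theorem exists_seq (hS : CuAxioms S) {f : CuFunctional S → ℝ≥0∞} (hf : f ∈ CuRealification S) :
    ∃ c : ℕ → CuFunctional S → ℝ≥0∞, (∀ k, c k ∈ CuRealification S) ∧ Monotone c ∧
      (∀ k, WayBelow (c k) (c (k + 1))) ∧ (∀ k, WayBelow (c k) f) ∧ f = ⨆ k, c k := by
  obtain ⟨s, n, hn, hw, h⟩ := exists_basic_seq hS hf
  have hmem : ∀ k, basic (s k) (n k) ∈ CuRealification S := fun k => basic_mem _ (hn k)
  refine ⟨fun k => basic (s k) (n k), hmem,
    monotone_nat_of_le_succ fun k => (hw k).le (hmem _), hw, fun k => ?_, h⟩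
  refine (hw k).mono le_rfl ?_
  rw [h]
  exact le_iSup (fun k => basic (s k) (n k)) (k + 1)

theorem iSup_mem (hS : CuAxioms S) {f : ℕ → CuFunctional S → ℝ≥0∞}
    (hf : ∀ k, f k ∈ CuRealification S) (hm : Monotone f) : ⨆ k, f k ∈ CuRealification S := by
  choose s n hn hw h using fun i => exists_basic_seq hS (hf i)
  obtain ⟨M, hM, he⟩ := exists_diagonal (b := fun i k => basic (s i k) (n i k))
    (fun i k => basic_mem _ (hn i k))
    (fun i => monotone_nat_of_le_succ fun k => (hw i k).le (basic_mem _ (hn i _)))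
    hw (by simpa only [← h] using hm)
  refine ⟨fun N => s N (M N), fun N => n N (M N), fun N => hn _ _,
    monotone_nat_of_le_succ fun k => (hM k).le (basic_mem _ (hn _ _)), fun φ => ?_⟩
  simp only [← h] at he
  rw [← he, iSup_apply]
  rfl

end Basic

end CuRealification

/-! ### Real multiples, and the analogues of O3, O5 and O6 in the realification. -/

namespace CuRealification

section Calculus

variable {S : Type*} [AddCommMonoid S] [PartialOrder S]

theorem smul_apply (c : ℝ≥0) (f : CuFunctional S → ℝ≥0∞) (φ : CuFunctional S) :
    (c • f) φ = (c : ℝ≥0∞) * f φ := rfl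

theorem smul_mono_right (c : ℝ≥0) {f g : CuFunctional S → ℝ≥0∞} (h : f ≤ g) : c • f ≤ c • g :=
  fun φ => mul_le_mul_right (h φ) (c : ℝ≥0∞)

theorem smul_mono_left {c d : ℝ≥0} (h : c ≤ d) (f : CuFunctional S → ℝ≥0∞) : c • f ≤ d • f :=
  fun φ => mul_le_mul_left (ENNReal.coe_le_coe.mpr h) (f φ)

theorem smul_iSup (c : ℝ≥0) (f : ℕ → CuFunctional S → ℝ≥0∞) :
    c • ⨆ k, f k = ⨆ k, c • f k := by
  funext φ
  simp only [smul_apply, iSup_apply, ENNReal.mul_iSup]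

theorem zero_wayBelow (f : CuFunctional S → ℝ≥0∞) : WayBelow 0 f :=
  fun _ _ _ _ => ⟨0, fun _ => bot_le⟩

theorem smul_basic (p : ℕ) {q : ℕ} (hq : 0 < q) (s : S) (n : ℕ) :
    ((p : ℝ≥0) / q) • basic s n = basic (p • s) (q * n) := by
  funext φ
  have hq0 : (q : ℝ≥0) ≠ 0 := by exact_mod_cast hq.ne'
  rw [smul_apply, basic, basic, φ.map_nsmul, Nat.cast_mul, ENNReal.coe_div hq0, div_eq_mul_inv,
    div_eq_mul_inv, div_eq_mul_inv,
    ENNReal.mul_inv (Or.inr (ENNReal.natCast_ne_top _)) (Or.inl (ENNReal.natCast_ne_top _))]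
  simp only [ENNReal.coe_natCast]
  ring

theorem exists_nat_div_eq_toNNReal (x : ℚ) : ∃ p q : ℕ, 0 < q ∧ Real.toNNReal x = (p : ℝ≥0) / q := by
  rcases le_total x 0 with h | h
  · exact ⟨0, 1, one_pos, by simpa using h⟩
  · refine ⟨x.num.toNat, x.den, x.den_pos, ?_⟩
    rw [← NNReal.coe_inj, Real.coe_toNNReal _ (by exact_mod_cast h)]
    have h1 : ((x.num.toNat : ℤ) : ℝ) = (x.num : ℝ) := by
      rw [Int.toNat_of_nonneg (Rat.num_nonneg.mpr h)]
    push_cast at h1 ⊢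
    rw [h1]
    exact Rat.cast_def x

variable [IsOrderedAddMonoid S]

/-- Rational multiples of `ŝ / n` have the same form, and a real multiple is an increasing supremum
of rational ones. -/
theorem smul_mem (hS : CuAxioms S) (c : ℝ≥0) {f : CuFunctional S → ℝ≥0∞}
    (hf : f ∈ CuRealification S) : c • f ∈ CuRealification S := by
  have hrat : ∀ p q : ℕ, 0 < q → ((p : ℝ≥0) / q) • f ∈ CuRealification S := by
    intro p q hq
    obtain ⟨s, n, hn, hw, rfl⟩ := exists_basic_seq hS hf
    rw [smul_iSup]
    refine iSup_mem hS (fun k => ?_) (monotone_nat_of_le_succ fun k =>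
      smul_mono_right _ ((hw k).le (basic_mem _ (hn _))))
    rw [smul_basic p hq]
    exact basic_mem _ (Nat.mul_pos hq (hn k))
  obtain ⟨x, hx, -, hlim⟩ := Real.exists_seq_rat_strictMono_tendsto (c : ℝ)
  have hmono : Monotone fun k => Real.toNNReal (x k) := fun i j hij =>
    Real.toNNReal_le_toNNReal (by exact_mod_cast hx.monotone hij)
  have hc : ⨆ k, ((Real.toNNReal (x k) : ℝ≥0) : ℝ≥0∞) = c := by
    refine iSup_eq_of_tendsto (fun i j hij => ENNReal.coe_le_coe.mpr (hmono hij)) ?_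
    rw [ENNReal.tendsto_coe]
    have := (continuous_real_toNNReal.tendsto (c : ℝ)).comp hlim
    rwa [Real.toNNReal_coe] at this
  have : c • f = ⨆ k, Real.toNNReal (x k) • f := by
    funext φ
    simp only [iSup_apply, smul_apply, ← ENNReal.iSup_mul, hc]
  rw [this]
  refine iSup_mem hS (fun k => ?_) (fun i j hij => smul_mono_left (hmono hij) f)
  obtain ⟨p, q, hq, h⟩ := exists_nat_div_eq_toNNReal (x k)
  rw [h]
  exact hrat p q hq

namespace WayBelow

theorem smul (hS : CuAxioms S) (c : ℝ≥0) {f g : CuFunctional S → ℝ≥0∞} (h : WayBelow f g) :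
    WayBelow (c • f) (c • g) := by
  rcases eq_or_ne c 0 with rfl | hc
  · rw [zero_smul]
    exact zero_wayBelow _
  intro u hu hm hgu
  obtain ⟨k, hk⟩ := h (fun k => c⁻¹ • u k) (fun k => smul_mem hS _ (hu k))
    (fun i j hij => smul_mono_right _ (hm hij)) (by
      rw [← smul_iSup]
      have := smul_mono_right c⁻¹ hgu
      rwa [smul_smul, inv_mul_cancel₀ hc, one_smul] at this)
  refine ⟨k, ?_⟩
  have := smul_mono_right c hk
  rwa [smul_smul, mul_inv_cancel₀ hc, one_smul] at this

theorem interpolate (hS : CuAxioms S) {f g : CuFunctional S → ℝ≥0∞} (hg : g ∈ CuRealification S)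
    (h : WayBelow f g) : ∃ x ∈ CuRealification S, WayBelow f x ∧ WayBelow x g := by
  obtain ⟨c, hc, hm, hw, hcg, hs⟩ := exists_seq hS hg
  obtain ⟨k, hk⟩ := h c hc hm hs.le
  exact ⟨c (k + 1), hc _, (hw k).mono hk le_rfl, hcg _⟩

theorem exists_basic (hS : CuAxioms S) {f g : CuFunctional S → ℝ≥0∞} (hg : g ∈ CuRealification S)
    (h : WayBelow f g) : ∃ (s : S) (n : ℕ), 0 < n ∧ WayBelow f (basic s n) ∧
      WayBelow (basic s n) g := by
  obtain ⟨s, n, hn, hw, rfl⟩ := exists_basic_seq hS hg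
  have hm : Monotone fun k => basic (s k) (n k) :=
    monotone_nat_of_le_succ fun k => (hw k).le (basic_mem _ (hn _))
  obtain ⟨k, hk⟩ := h _ (fun k => basic_mem _ (hn k)) hm le_rfl
  exact ⟨s (k + 1), n (k + 1), hn _, (hw k).mono hk le_rfl,
    (hw (k + 1)).mono le_rfl (le_iSup (fun k => basic (s k) (n k)) _)⟩

/-- Stores the slack used up later: the factor `(k + 1) / (k + 2)` and `s' ≪ s` pay for the
comparison in `S`, and `s'' ≪ s'` pays for O5 or O6. Allowing all large `k` lets two elements share
one factor. -/
theorem le_basic_nsmul (hS : CuAxioms S) {f : CuFunctional S → ℝ≥0∞} {s : S} {n : ℕ} (hn : 0 < n)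
    (h : WayBelow f (basic s n)) : ∃ K : ℕ, ∀ k ≥ K, ∃ s'' s', CompactlyContained s'' s' ∧
      CompactlyContained s' s ∧ f ≤ basic ((k + 1) • s'') ((k + 2) * n) := by
  obtain ⟨u, hu, huw, hus, hl⟩ := hS.exists_seq s
  have hm := monotone_basic_nsmul hu hn
  obtain ⟨K, hK⟩ := h _ (fun k => basic_mem _ (Nat.mul_pos (by omega) hn)) hm
    (iSup_basic_nsmul hu hl n).ge
  exact ⟨K, fun k hk => ⟨u k, u (k + 1), huw k, hus _, hK.trans (hm hk)⟩⟩

theorem add (hS : CuAxioms S) {f f' g g' : CuFunctional S → ℝ≥0∞} (hf : f ∈ CuRealification S)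
    (hg : g ∈ CuRealification S) (hff : WayBelow f' f) (hgg : WayBelow g' g) :
    WayBelow (f' + g') (f + g) := by
  obtain ⟨s, n, hn, h1, h2⟩ := hff.exists_basic hS hf
  obtain ⟨t, m, hm, h3, h4⟩ := hgg.exists_basic hS hg
  obtain ⟨K, hK⟩ := h1.le_basic_nsmul hS hn
  obtain ⟨L, hL⟩ := h3.le_basic_nsmul hS hm
  obtain ⟨s'', s', hss, hs, hfs⟩ := hK (max K L) (le_max_left _ _)
  obtain ⟨t'', t', htt, ht, hgt⟩ := hL (max K L) (le_max_right _ _)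
  generalize max K L = k at hfs hgt
  have h5 := basic_wayBelow hS (hS.O3 _ _ _ _ (hS.nsmul_compactlyContained
    (hss.mono le_rfl hs.le) m) (hS.nsmul_compactlyContained (htt.mono le_rfl ht.le) n))
    (Nat.mul_pos hn hm) (Nat.lt_succ_self (k + 1))
  refine h5.mono ((add_le_add hfs hgt).trans_eq ?_) ?_
  · rw [← smul_basic (k + 1) (by omega : 0 < k + 1 + 1), ← smul_basic (k + 1) (by omega : 0 < k + 2),
      ← smul_basic (k + 1) (by omega : 0 < k + 2), ← smul_add, basic_add_basic _ _ hn hm]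
  · rw [← basic_add_basic _ _ hn hm]
    exact add_le_add (h2.le hf) (h4.le hg)

theorem sum (hS : CuAxioms S) {ι : Type*} (s : Finset ι) {f g : ι → CuFunctional S → ℝ≥0∞}
    (hg : ∀ i, g i ∈ CuRealification S) (h : ∀ i, WayBelow (f i) (g i)) :
    WayBelow (∑ i ∈ s, f i) (∑ i ∈ s, g i) := by
  classical
  induction s using Finset.induction_on with
  | empty => simpa using zero_wayBelow _
  | insert a s ha ih =>
    rw [Finset.sum_insert ha, Finset.sum_insert ha]
    exact add hS (hg a) (sum_mem fun i _ => hg i) (h a) ih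

theorem exists_add (hS : CuAxioms S) {f g₁ g₂ : CuFunctional S → ℝ≥0∞}
    (hg₁ : g₁ ∈ CuRealification S) (hg₂ : g₂ ∈ CuRealification S) (h : WayBelow f (g₁ + g₂)) :
    ∃ x₁ ∈ CuRealification S, ∃ x₂ ∈ CuRealification S, WayBelow x₁ g₁ ∧ WayBelow x₂ g₂ ∧
      f ≤ x₁ + x₂ := by
  obtain ⟨c, hc, hcm, -, hcg, hcs⟩ := exists_seq hS hg₁
  obtain ⟨d, hd, hdm, -, hdg, hds⟩ := exists_seq hS hg₂
  obtain ⟨k, hk⟩ := h (fun k => c k + d k) (fun k => add_mem (hc k) (hd k)) (hcm.add hdm) (by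
    intro φ
    conv_lhs => rw [hcs, hds]
    simp only [Pi.add_apply, iSup_apply]
    exact (ENNReal.iSup_add_iSup_of_monotone (fun i j hij => hcm hij φ)
      (fun i j hij => hdm hij φ)).le)
  exact ⟨c k, hc k, d k, hd k, hcg k, hdg k, hk⟩

theorem exists_sum (hS : CuAxioms S) {ι : Type*} (s : Finset ι) {g : ι → CuFunctional S → ℝ≥0∞}
    (hg : ∀ i, g i ∈ CuRealification S) {f : CuFunctional S → ℝ≥0∞}
    (h : WayBelow f (∑ i ∈ s, g i)) :
    ∃ x : ι → CuFunctional S → ℝ≥0∞, (∀ i, x i ∈ CuRealification S) ∧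
      (∀ i, WayBelow (x i) (g i)) ∧ f ≤ ∑ i ∈ s, x i := by
  classical
  induction s using Finset.induction_on generalizing f with
  | empty =>
    exact ⟨fun _ => 0, fun _ => zero_mem _, fun _ => zero_wayBelow _, by
      simpa using h.le (by simp)⟩
  | insert a s ha ih =>
    rw [Finset.sum_insert ha] at h
    obtain ⟨x₁, hx₁, x₂, -, h1, h2, h3⟩ := h.exists_add hS (hg a) (sum_mem fun i _ => hg i)
    obtain ⟨y, hy, hyg, h4⟩ := ih h2
    refine ⟨Function.update y a x₁, fun i => ?_, fun i => ?_, ?_⟩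
    · rcases eq_or_ne i a with rfl | hi
      · simpa using hx₁
      · simpa [hi] using hy i
    · rcases eq_or_ne i a with rfl | hi
      · simpa using h1
      · simpa [hi] using hyg i
    · rw [Finset.sum_insert ha, Function.update_self, Finset.sum_update_of_notMem ha]
      exact h3.trans (add_le_add le_rfl h4)

/-- Almost algebraic order of the realification. -/
theorem exists_remainder (hS : CuAxioms S) {x' x g' g : CuFunctional S → ℝ≥0∞}
    (hx : x ∈ CuRealification S) (hg : g ∈ CuRealification S) (hxx : WayBelow x' x) (hxg : x ≤ g)
    (hgg : WayBelow g' g) :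
    ∃ r ∈ CuRealification S, x' + r ≤ g ∧ g' ≤ x + r := by
  obtain ⟨z, n, hn, h1, h2⟩ := hxx.exists_basic hS hx
  obtain ⟨t, m, hm, h3, h4, h5⟩ : ∃ (t : S) (m : ℕ), 0 < m ∧ basic z n ≤ basic t m ∧
      g' ≤ basic t m ∧ basic t m ≤ g := by
    obtain ⟨s, k, hk, hw, rfl⟩ := exists_basic_seq hS hg
    have hmono : Monotone fun i => basic (s i) (k i) :=
      monotone_nat_of_le_succ fun i => (hw i).le (basic_mem _ (hk _))
    obtain ⟨i, hi⟩ := h2 _ (fun i => basic_mem _ (hk i)) hmono hxg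
    obtain ⟨j, hj⟩ := hgg _ (fun i => basic_mem _ (hk i)) hmono le_rfl
    exact ⟨s (max i j), k (max i j), hk _, hi.trans (hmono (le_max_left i j)),
      hj.trans (hmono (le_max_right i j)), le_iSup (fun i => basic (s i) (k i)) _⟩
  obtain ⟨k, hk⟩ := h1.le_basic_nsmul hS hn
  obtain ⟨z'', z', hzz, hz, hxz⟩ := hk k le_rfl
  -- The tolerance is the factor in `hxz`: `p / q ≥ (k + 1) / (k + 2)` keeps the result above `x'`,
  -- and `p ≤ q` keeps it below `x`.
  obtain ⟨p, q, hp, hpq, hpq', hle⟩ := exists_nsmul_le_nsmul hS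
    (hS.nsmul_compactlyContained hz m) ((basic_le_basic_iff hn hm).mp h3)
    (Nat.lt_succ_self (k + 1))
  obtain ⟨r, hr1, hr2⟩ := hS.O5 _ _ _ (hS.nsmul_compactlyContained
    (hS.nsmul_compactlyContained hzz m) p) hle
  have hq : 0 < q := hp.trans_le hpq
  have hden : 0 < q * (n * m) := by positivity
  have heq : basic (q • n • t) (q * (n * m)) = basic t m := by
    rw [basic_nsmul_mul _ hq, basic_nsmul_mul _ hn]
  refine ⟨basic r (q * (n * m)), basic_mem _ hden, ?_, ?_⟩
  · calc x' + basic r (q * (n * m))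
        ≤ basic (p • m • z'') (q * (n * m)) + basic r (q * (n * m)) := by
          refine add_le_add (hxz.trans ?_) le_rfl
          rw [← mul_nsmul']
          refine basic_nsmul_le_basic_nsmul _ (by positivity) hden ?_
          calc (k + 1) * (q * (n * m)) = ((k + 1) * q) * (n * m) := by ring
            _ ≤ ((k + 1 + 1) * p) * (n * m) := Nat.mul_le_mul_right _ hpq'
            _ = _ := by ring
      _ ≤ basic (q • n • t) (q * (n * m)) := by
          rw [← basic_add]
          exact basic_mono hr1 _
      _ ≤ g := heq.trans_le h5
  · calc g' ≤ basic (q • n • t) (q * (n * m)) := h4.trans_eq heq.symm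
      _ ≤ basic (p • m • z') (q * (n * m)) + basic r (q * (n * m)) := by
          rw [← basic_add]
          exact basic_mono hr2 _
      _ ≤ x + basic r (q * (n * m)) := by
          refine add_le_add (le_trans ?_ (h2.le hx)) le_rfl
          refine (basic_mono (nsmul_le_nsmul_right (nsmul_le_nsmul_right hz.le m) p) _).trans ?_
          rw [← mul_nsmul']
          conv_rhs => rw [← one_nsmul z]
          refine basic_nsmul_le_basic_nsmul _ hden hn ?_
          calc p * m * n ≤ q * m * n := by gcongr
            _ = 1 * (q * (n * m)) := by ring

/-- Weak Riesz decomposition in the realification. -/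
theorem exists_le_add (hS : CuAxioms S) {f' f g₁ g₂ : CuFunctional S → ℝ≥0∞}
    (hf : f ∈ CuRealification S) (hg₁ : g₁ ∈ CuRealification S) (hg₂ : g₂ ∈ CuRealification S)
    (hff : WayBelow f' f) (h : f ≤ g₁ + g₂) :
    ∃ r₁ ∈ CuRealification S, ∃ r₂ ∈ CuRealification S, f' ≤ r₁ + r₂ ∧ r₁ ≤ g₁ ∧ r₁ ≤ f ∧
      r₂ ≤ g₂ ∧ r₂ ≤ f := by
  obtain ⟨s, n, hn, h1, h2⟩ := hff.exists_basic hS hf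
  obtain ⟨y₁, hy₁, y₂, hy₂, hyg₁, hyg₂, hy⟩ := (h2.mono le_rfl h).exists_add hS hg₁ hg₂
  obtain ⟨t₁, m₁, hm₁, h3, h4⟩ := hyg₁.exists_basic hS hg₁
  obtain ⟨t₂, m₂, hm₂, h5, h6⟩ := hyg₂.exists_basic hS hg₂
  have hle : basic s n ≤ basic (m₂ • t₁ + m₁ • t₂) (m₁ * m₂) := by
    rw [← basic_add_basic _ _ hm₁ hm₂]
    exact hy.trans (add_le_add (h3.le (basic_mem _ hm₁)) (h5.le (basic_mem _ hm₂)))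
  obtain ⟨k, hk⟩ := h1.le_basic_nsmul hS hn
  obtain ⟨s'', s', hss, hs, hfs⟩ := hk k le_rfl
  obtain ⟨p, q, hp, hpq, hpq', hle'⟩ := exists_nsmul_le_nsmul hS
    (hS.nsmul_compactlyContained hs (m₁ * m₂))
    ((basic_le_basic_iff hn (Nat.mul_pos hm₁ hm₂)).mp hle) (Nat.lt_succ_self (k + 1))
  rw [nsmul_add, nsmul_add] at hle'
  obtain ⟨r₁, r₂, hr, hr₁, hr₁s, hr₂, hr₂s⟩ := hS.O6 _ _ _ hle' _
    (hS.nsmul_compactlyContained (hS.nsmul_compactlyContained hss (m₁ * m₂)) p)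
  have hq : 0 < q := hp.trans_le hpq
  have hden : 0 < q * (n * (m₁ * m₂)) := by positivity
  have hsf : basic (p • (m₁ * m₂) • s') (q * (n * (m₁ * m₂))) ≤ f := by
    refine le_trans ?_ (h2.le hf)
    refine (basic_mono (nsmul_le_nsmul_right (nsmul_le_nsmul_right hs.le _) _) _).trans ?_
    rw [← mul_nsmul']
    conv_rhs => rw [← one_nsmul s]
    refine basic_nsmul_le_basic_nsmul _ hden hn ?_
    calc p * (m₁ * m₂) * n ≤ q * (m₁ * m₂) * n := by gcongr
      _ = 1 * (q * (n * (m₁ * m₂))) := by ring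
  refine ⟨_, basic_mem r₁ hden, _, basic_mem r₂ hden, ?_, ?_, (basic_mono hr₁s _).trans hsf, ?_,
    (basic_mono hr₂s _).trans hsf⟩
  · rw [← basic_add]
    refine hfs.trans (le_trans ?_ (basic_mono hr _))
    rw [← mul_nsmul']
    refine basic_nsmul_le_basic_nsmul _ (by positivity) hden ?_
    calc (k + 1) * (q * (n * (m₁ * m₂))) = ((k + 1) * q) * (n * (m₁ * m₂)) := by ring
      _ ≤ ((k + 1 + 1) * p) * (n * (m₁ * m₂)) := Nat.mul_le_mul_right _ hpq'
      _ = _ := by ring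
  · refine (basic_mono hr₁ _).trans (le_trans (le_of_eq ?_) (h4.le hg₁))
    rw [basic_nsmul_mul _ hq, basic_nsmul_mul _ hn, mul_comm m₁ m₂, basic_nsmul_mul _ hm₂]
  · refine (basic_mono hr₂ _).trans (le_trans (le_of_eq ?_) (h6.le hg₂))
    rw [basic_nsmul_mul _ hq, basic_nsmul_mul _ hn, basic_nsmul_mul _ hm₁]

theorem exists_le_sum (hS : CuAxioms S) {ι : Type*} (s : Finset ι) {f' f : CuFunctional S → ℝ≥0∞}
    {g : ι → CuFunctional S → ℝ≥0∞} (hf : f ∈ CuRealification S)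
    (hg : ∀ i, g i ∈ CuRealification S) (hff : WayBelow f' f) (h : f ≤ ∑ i ∈ s, g i) :
    ∃ r : ι → CuFunctional S → ℝ≥0∞, (∀ i, r i ∈ CuRealification S) ∧ (∀ i, r i ≤ g i) ∧
      (∀ i, r i ≤ f) ∧ f' ≤ ∑ i ∈ s, r i := by
  classical
  induction s using Finset.induction_on generalizing f f' with
  | empty =>
    exact ⟨fun _ => 0, fun _ => zero_mem _, fun _ _ => bot_le, fun _ _ => bot_le, by
      simpa using (hff.le hf).trans h⟩
  | insert a s ha ih =>
    rw [Finset.sum_insert ha] at h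
    obtain ⟨x, hx, hfx, hxf⟩ := hff.interpolate hS hf
    obtain ⟨r₁, hr₁, r₂, hr₂, hr, hr₁g, hr₁f, hr₂g, hr₂f⟩ :=
      hxf.exists_le_add hS hf (hg a) (sum_mem fun i _ => hg i) h
    obtain ⟨y₁, -, y₂, -, hy₁, hy₂, hy⟩ := (hfx.mono le_rfl hr).exists_add hS hr₁ hr₂
    obtain ⟨y, hym, hyg, hyf, hys⟩ := ih hr₂ hy₂ hr₂g
    refine ⟨Function.update y a r₁, fun i => ?_, fun i => ?_, fun i => ?_, ?_⟩
    · rcases eq_or_ne i a with rfl | hi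
      · simpa using hr₁
      · simpa [hi] using hym i
    · rcases eq_or_ne i a with rfl | hi
      · simpa using hr₁g
      · simpa [hi] using hyg i
    · rcases eq_or_ne i a with rfl | hi
      · simpa using hr₁f
      · simpa [hi] using (hyf i).trans hr₂f
    · rw [Finset.sum_insert ha, Function.update_self, Finset.sum_update_of_notMem ha]
      exact hy.trans (add_le_add (hy₁.le hr₁) hys)

end WayBelow

/-- By `iSup_mem`, suprema of increasing sequences in the realification are pointwise suprema. -/
theorem compactlyContained_iff (hS : CuAxioms S) (f g : CuRealification S) :
    CompactlyContained f g ↔ WayBelow (f : CuFunctional S → ℝ≥0∞) g := by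
  constructor
  · intro h u hu hm hgu
    let v : ℕ → CuRealification S := fun k => ⟨u k, hu k⟩
    refine h v ⟨⨆ k, u k, iSup_mem hS hu hm⟩ (fun i j hij => hm hij) ⟨?_, ?_⟩ hgu
    · rintro _ ⟨k, rfl⟩
      exact le_iSup u k
    · intro b hb
      have hle : ⨆ k, u k ≤ (b : CuFunctional S → ℝ≥0∞) := iSup_le fun k => hb ⟨k, rfl⟩
      exact hle
  · intro h u b hm hb hgb
    have hm' : Monotone fun k => (u k : CuFunctional S → ℝ≥0∞) := fun i j hij => hm hij
    refine h (fun k => (u k : CuFunctional S → ℝ≥0∞)) (fun k => (u k).2) hm' ?_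
    refine le_trans (b := (b : CuFunctional S → ℝ≥0∞)) hgb ?_
    have hle : b ≤ ⟨_, iSup_mem hS (fun k => (u k).2) hm'⟩ := hb.2 (by
      rintro _ ⟨k, rfl⟩
      exact le_iSup (fun k => (u k : CuFunctional S → ℝ≥0∞)) k)
    exact hle

end Calculus

end CuRealification

/-! ### From weak decomposition to Riesz decomposition and refinement. -/

namespace CuRealification

/-- Cancellation of a family from a sum, up to small gaps. -/
theorem le_smul_sum_add_sum {S : Type*} [AddCommMonoid S] [PartialOrder S] {ι : Type*} [Fintype ι]
    {h g a b k : ι → CuFunctional S → ℝ≥0∞}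
    {N : ℕ} (hN : 0 < N) (hah : ∀ j, a j ≤ h j) (hgap : ∀ j, b j ≤ a j + (N : ℝ≥0)⁻¹ • h j)
    (hgbk : ∀ j, g j ≤ b j + k j) {e : CuFunctional S → ℝ≥0∞}
    (he : ∑ j, a j + e ≤ ∑ j, g j) : e ≤ (N : ℝ≥0)⁻¹ • ∑ j, h j + ∑ j, k j := by
  have h1 : ∑ j, a j + e ≤ ∑ j, a j + ((N : ℝ≥0)⁻¹ • ∑ j, h j + ∑ j, k j) := by
    refine he.trans ?_
    rw [Finset.smul_sum, ← Finset.sum_add_distrib, ← Finset.sum_add_distrib]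
    refine Finset.sum_le_sum fun j _ => (hgbk j).trans ?_
    rw [← add_assoc]
    exact add_le_add (hgap j) le_rfl
  have h2 : ∑ j, a j ≤ ∑ j, h j := Finset.sum_le_sum fun j _ => hah j
  intro φ
  have h3 := h1 φ
  have h4 := h2 φ
  simp only [Pi.add_apply, smul_apply] at h3 h4 ⊢
  -- Where `∑ h` is infinite, so is the right-hand side; elsewhere `∑ a` is finite and cancels.
  by_cases ht : (∑ j, h j) φ = ∞
  · rw [ht, ENNReal.mul_top, top_add]
    · exact le_top
    · simp [hN.ne']
  · exact (ENNReal.add_le_add_iff_left (ne_top_of_le_ne_top ht h4)).mp h3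

/-- The functions `f' ≪ f ≤ ∑ g` admit a decomposition reaching at least `α • f'`. -/
def HasDecomposition (S : Type*) [AddCommMonoid S] [PartialOrder S] (ι : Type*) [Fintype ι]
    (α : ℝ≥0) : Prop :=
  ∀ (f' f : CuFunctional S → ℝ≥0∞) (g : ι → CuFunctional S → ℝ≥0∞), f ∈ CuRealification S →
    (∀ j, g j ∈ CuRealification S) → WayBelow f' f → f ≤ ∑ j, g j →
    ∃ h : ι → CuFunctional S → ℝ≥0∞, (∀ j, h j ∈ CuRealification S) ∧ (∀ j, h j ≤ g j) ∧
      ∑ j, h j ≤ f ∧ α • f' ≤ ∑ j, h j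

theorem HasDecomposition.of_le {S : Type*} [AddCommMonoid S] [PartialOrder S] {ι : Type*} [Fintype ι] {α β : ℝ≥0} (h : β ≤ α)
    (H : HasDecomposition S ι α) : HasDecomposition S ι β := by
  intro f' f g hf hg hff hfg
  obtain ⟨h', h1, h2, h3, h4⟩ := H f' f g hf hg hff hfg
  exact ⟨h', h1, h2, h3, (smul_mono_left h f').trans h4⟩

section Refinement

variable {S : Type*} [AddCommMonoid S] [PartialOrder S] [IsOrderedAddMonoid S]

/-- Between `x' ≪ x` one finds `a ≪ b` whose gap is at most a small multiple of `x`: the averages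
of two consecutive parts of a `≪`-increasing chain. -/
theorem WayBelow.exists_small_gap (hS : CuAxioms S) {x' x : CuFunctional S → ℝ≥0∞}
    (hx : x ∈ CuRealification S) (h : WayBelow x' x) {N : ℕ} (hN : 0 < N) :
    ∃ a ∈ CuRealification S, ∃ b ∈ CuRealification S, x' ≤ a ∧ WayBelow a b ∧ b ≤ x ∧
      b ≤ a + (N : ℝ≥0)⁻¹ • x := by
  obtain ⟨c, hc, hm, hw, hcx, hs⟩ := exists_seq hS hx
  obtain ⟨K, hK⟩ := h c hc hm hs.le
  have hN0 : (N : ℝ≥0) ≠ 0 := by exact_mod_cast hN.ne'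
  have hconst : ∀ y : CuFunctional S → ℝ≥0∞, (N : ℝ≥0)⁻¹ • ∑ _i ∈ Finset.range N, y = y := by
    intro y
    rw [Finset.sum_const, Finset.card_range, ← Nat.cast_smul_eq_nsmul ℝ≥0, smul_smul,
      inv_mul_cancel₀ hN0, one_smul]
  refine ⟨(N : ℝ≥0)⁻¹ • ∑ i ∈ Finset.range N, c (K + i),
    smul_mem hS _ (sum_mem fun i _ => hc _),
    (N : ℝ≥0)⁻¹ • ∑ i ∈ Finset.range N, c (K + i + 1),
    smul_mem hS _ (sum_mem fun i _ => hc _), ?_,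
    (WayBelow.sum hS _ (fun i => hc _) fun i => hw _).smul hS _, ?_, ?_⟩
  · rw [← hconst x']
    exact smul_mono_right _ (Finset.sum_le_sum fun i _ => hK.trans (hm (Nat.le_add_right _ _)))
  · conv_rhs => rw [← hconst x]
    exact smul_mono_right _ (Finset.sum_le_sum fun i _ => (hcx _).le hx)
  -- The two sums telescope to a difference of one term `c (K + N) ≤ x`.
  · rw [← smul_add]
    refine smul_mono_right _ ?_
    calc ∑ i ∈ Finset.range N, c (K + i + 1)
        ≤ ∑ i ∈ Finset.range N, c (K + i + 1) + c (K + 0) := le_add_of_nonneg_right bot_le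
      _ = ∑ i ∈ Finset.range N, c (K + i) + c (K + N) := by
          rw [← Finset.sum_range_succ, Finset.sum_range_succ' (fun i => c (K + i))]
          rfl
      _ ≤ _ := add_le_add le_rfl ((hcx _).le hx)

/-- Subtracting a family `h ≤ g` from `g`, up to small gaps. -/
theorem exists_complement (hS : CuAxioms S) {ι : Type*}
    {h' h g' g : ι → CuFunctional S → ℝ≥0∞} (hh : ∀ j, h j ∈ CuRealification S)
    (hg : ∀ j, g j ∈ CuRealification S) (hhh : ∀ j, WayBelow (h' j) (h j))
    (hgg : ∀ j, WayBelow (g' j) (g j)) (hhg : ∀ j, h j ≤ g j) {N : ℕ} (hN : 0 < N) :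
    ∃ a b k : ι → CuFunctional S → ℝ≥0∞, (∀ j, a j ∈ CuRealification S) ∧
      (∀ j, b j ∈ CuRealification S) ∧ (∀ j, k j ∈ CuRealification S) ∧ (∀ j, h' j ≤ a j) ∧
      (∀ j, WayBelow (a j) (b j)) ∧ (∀ j, b j ≤ h j) ∧ (∀ j, b j ≤ a j + (N : ℝ≥0)⁻¹ • h j) ∧
      (∀ j, a j + k j ≤ g j) ∧ ∀ j, g' j ≤ b j + k j := by
  choose a ha b hb hha hab hbh hgap using fun j => (hhh j).exists_small_gap hS (hh j) hN
  choose k hk h1 h2 using fun j =>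
    (hab j).exists_remainder hS (hb j) (hg j) ((hbh j).trans (hhg j)) (hgg j)
  exact ⟨a, b, k, ha, hb, hk, hha, hab, hbh, hgap, h1, h2⟩

/-- Weight `h1` by `δ'` and `h2` by `δ`; the error `η * h` is paid for by the share `ε` of `h`. -/
theorem mul_le_convex_combination {α α' δ δ' ε ε' η : ℝ≥0} (hα : α + α' = 1) (hδ : δ + δ' = 1)
    (hε : ε + ε' = 1) (hη : η ≤ ε) {x a e h : ℝ≥0∞} (h1 : (α : ℝ≥0∞) * x ≤ a)
    (h2 : x ≤ a + e + η * h) :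
    ((ε' * (α + δ * α') : ℝ≥0) : ℝ≥0∞) * x ≤ ε' * (a + δ * e) + ε * h := by
  have h3 : α + δ * α' = δ' * α + δ := by
    calc α + δ * α' = (δ + δ') * α + δ * α' := by rw [hδ, one_mul]
      _ = δ' * α + δ * (α + α') := by ring
      _ = _ := by rw [hα, mul_one]
  have h4 : (δ' : ℝ≥0∞) + δ = 1 := by rw [add_comm]; exact_mod_cast hδ
  have h5 : ((ε' * δ * η : ℝ≥0) : ℝ≥0∞) ≤ ε := by
    rw [ENNReal.coe_le_coe]
    have hδ1 : δ ≤ 1 := hδ ▸ le_self_add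
    have hε1 : ε' ≤ 1 := hε ▸ le_add_self
    calc ε' * δ * η ≤ 1 * 1 * η := by gcongr
      _ ≤ ε := by simpa using hη
  rw [h3]
  calc ((ε' * (δ' * α + δ) : ℝ≥0) : ℝ≥0∞) * x = ε' * (δ' * (α * x) + δ * x) := by
        push_cast
        ring
    _ ≤ ε' * (δ' * a + δ * (a + e + η * h)) := by gcongr
    _ = ε' * ((δ' + δ) * a + δ * e) + ((ε' * δ * η : ℝ≥0) : ℝ≥0∞) * h := by
        push_cast
        ring
    _ ≤ _ := by
        rw [h4, one_mul]
        gcongr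

/-- A fraction `1 / card ι` of the missing part `α'` is recovered, up to a factor `ε'` arbitrarily
close to one. -/
theorem HasDecomposition.improve (hS : CuAxioms S) {ι : Type*} [Fintype ι] [Nonempty ι]
    {α α' δ' ε ε' : ℝ≥0} (hα : α + α' = 1) (hδ : (Fintype.card ι : ℝ≥0)⁻¹ + δ' = 1)
    (hε : ε + ε' = 1) (hε0 : ε ≠ 0) (H : HasDecomposition S ι α) :
    HasDecomposition S ι (ε' * (α + (Fintype.card ι : ℝ≥0)⁻¹ * α')) := by
  intro f' f g hf hg hff hfg
  set δ : ℝ≥0 := (Fintype.card ι : ℝ≥0)⁻¹ with hδdef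
  -- Two errors `∑ h / N` arise: from replacing `b` by `a`, and from the cancellation.
  obtain ⟨N, hN, hNε⟩ : ∃ N : ℕ, 0 < N ∧ (N : ℝ≥0)⁻¹ + (N : ℝ≥0)⁻¹ ≤ ε := by
    obtain ⟨M, hM⟩ := exists_nat_gt ((ε / 2)⁻¹)
    have hε2 : 0 < (ε / 2)⁻¹ := by
      have : 0 < ε := pos_iff_ne_zero.mpr hε0
      positivity
    refine ⟨M, by exact_mod_cast hε2.trans hM, ?_⟩
    have h1 : (M : ℝ≥0)⁻¹ ≤ ε / 2 := by
      have := inv_anti₀ hε2 hM.le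
      rwa [inv_inv] at this
    calc _ ≤ ε / 2 + ε / 2 := add_le_add h1 h1
      _ = ε := add_halves ε
  obtain ⟨f₁, hf₁, hf'1, hf₁f⟩ := hff.interpolate hS hf
  obtain ⟨f₂, hf₂, hf'2, hf₂₁⟩ := hf'1.interpolate hS hf₁
  obtain ⟨g', hg', hgg, hfg'⟩ := (hf₁f.mono le_rfl hfg).exists_sum hS Finset.univ hg
  obtain ⟨h, hh, hhg, hhf, hfh⟩ := H f₂ f₁ g' hf₁ hg' hf₂₁ hfg'
  obtain ⟨h', -, hhh, hfh'⟩ := ((hf'2.smul hS α).mono le_rfl hfh).exists_sum hS Finset.univ hh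
  obtain ⟨a, b, k, ha, hb, hk, hha, hab, hbh, hgap, hak, hbk⟩ := exists_complement hS hh hg hhh hgg
    (fun j => (hhg j).trans ((hgg j).le (hg j))) hN
  have hah : ∀ j, a j ≤ h j := fun j => ((hab j).le (hb j)).trans (hbh j)
  have hbmem : ∑ j, b j ∈ CuRealification S := sum_mem fun j _ => hb j
  have hhmem : ∑ j, h j ∈ CuRealification S := sum_mem fun j _ => hh j
  obtain ⟨e, he, hae, hbe⟩ := (WayBelow.sum hS Finset.univ hb hab).exists_remainder hS
    hbmem hf₁ ((Finset.sum_le_sum fun j _ => hbh j).trans hhf) hf₂₁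
  have hek := le_smul_sum_add_sum hN hah hgap hbk (hae.trans hfg')
  obtain ⟨b', -, e', -, hb', he', hfe⟩ := (hf'2.mono le_rfl hbe).exists_add hS hbmem he
  -- The index `none` carries the cancellation error, the others the remainders `k j`.
  obtain ⟨r, hr, hrk, hre, her⟩ := he'.exists_le_sum hS Finset.univ he
    (g := fun o : Option ι => o.elim ((N : ℝ≥0)⁻¹ • ∑ j, h j) k)
    (fun o => by
      cases o with
      | none => exact smul_mem hS _ hhmem
      | some j => exact hk j)
    (by rw [Fintype.sum_option]; exact hek)
  rw [Fintype.sum_option] at her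
  have hcard : ∑ j, δ • r (some j) ≤ e := by
    have hc : (Fintype.card ι : ℝ≥0) ≠ 0 := by exact_mod_cast Fintype.card_ne_zero
    calc ∑ j, δ • r (some j) ≤ ∑ _j : ι, δ • e :=
          Finset.sum_le_sum fun j _ => smul_mono_right _ (hre _)
      _ = e := by
          rw [Finset.sum_const, Finset.card_univ, ← Nat.cast_smul_eq_nsmul ℝ≥0, smul_smul, hδdef,
            mul_inv_cancel₀ hc, one_smul]
  have hδ1 : δ ≤ 1 := hδ ▸ le_self_add
  -- A convex combination of two families that respect the upper bounds; the share of `h`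
  -- compensates the errors.
  refine ⟨fun j => ε' • (a j + δ • r (some j)) + ε • h j, fun j => ?_, fun j => ?_, ?_, ?_⟩
  · exact add_mem (smul_mem hS _ (add_mem (ha j) (smul_mem hS _ (hr _)))) (smul_mem hS _ (hh j))
  · calc ε' • (a j + δ • r (some j)) + ε • h j ≤ ε' • g j + ε • g j := by
          refine add_le_add (smul_mono_right _ (le_trans (add_le_add le_rfl ?_) (hak j)))
            (smul_mono_right _ ((hhg j).trans ((hgg j).le (hg j))))
          calc δ • r (some j) ≤ (1 : ℝ≥0) • r (some j) := smul_mono_left hδ1 _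
            _ ≤ k j := by rw [one_smul]; exact hrk (some j)
      _ = g j := by rw [← add_smul, add_comm, hε, one_smul]
  · rw [Finset.sum_add_distrib, ← Finset.smul_sum, ← Finset.smul_sum, Finset.sum_add_distrib]
    calc _ ≤ ε' • f₁ + ε • f₁ := by
          refine add_le_add (smul_mono_right _ ((add_le_add le_rfl hcard).trans hae))
            (smul_mono_right _ hhf)
      _ = f₁ := by rw [← add_smul, add_comm, hε, one_smul]
      _ ≤ f := hf₁f.le hf
  · rw [Finset.sum_add_distrib, ← Finset.smul_sum, ← Finset.smul_sum, Finset.sum_add_distrib,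
      ← Finset.smul_sum]
    have h1 : α • f' ≤ ∑ j, a j := hfh'.trans (Finset.sum_le_sum fun j _ => hha j)
    have h2 : f' ≤ ∑ j, a j + ∑ j, r (some j) + ((N : ℝ≥0)⁻¹ + (N : ℝ≥0)⁻¹) • ∑ j, h j := by
      have hbsum : ∑ j, b j ≤ ∑ j, a j + (N : ℝ≥0)⁻¹ • ∑ j, h j := by
        rw [Finset.smul_sum, ← Finset.sum_add_distrib]
        exact Finset.sum_le_sum fun j _ => hgap j
      calc f' ≤ ∑ j, b j + (r none + ∑ j, r (some j)) :=
            hfe.trans (add_le_add (hb'.le hbmem) her)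
        _ ≤ (∑ j, a j + (N : ℝ≥0)⁻¹ • ∑ j, h j) +
            ((N : ℝ≥0)⁻¹ • ∑ j, h j + ∑ j, r (some j)) :=
            add_le_add hbsum (add_le_add (hrk none) le_rfl)
        _ = _ := by
            rw [add_smul]
            abel
    intro φ
    exact mul_le_convex_combination hα hδ hε hNε (h1 φ) (h2 φ)

theorem hasDecomposition (hS : CuAxioms S) (ι : Type*) [Fintype ι] [Nonempty ι] {α : ℝ≥0}
    (hα : α < 1) : HasDecomposition S ι α := by
  set δ : ℝ≥0 := (Fintype.card ι : ℝ≥0)⁻¹ with hδdef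
  have hcard : (1 : ℝ≥0) ≤ Fintype.card ι := by exact_mod_cast Fintype.card_pos
  have hδ0 : 0 < δ := inv_pos.mpr (by exact_mod_cast Fintype.card_pos)
  have hδ1 : δ ≤ 1 := inv_le_one_of_one_le₀ hcard
  -- Each round could shrink the missing part by almost `1 - δ`; settling for `1 - δ / 2` leaves
  -- room for the loss `ε = δ / 2 * q ^ k`.
  have key : ∀ k : ℕ, HasDecomposition S ι (1 - (1 - δ / 2) ^ k) := by
    intro k
    induction k with
    | zero =>
      intro f' f g hf hg hff hfg
      refine ⟨fun _ => 0, fun _ => zero_mem _, fun _ _ => bot_le, ?_, ?_⟩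
      · rw [Finset.sum_const_zero]
        exact fun _ => bot_le
      · rw [pow_zero, tsub_self, zero_smul]
        exact fun _ => bot_le
    | succ k ih =>
      set q : ℝ≥0 := 1 - δ / 2 with hq
      have hδ2 : δ / 2 ≤ 1 := (half_le_self bot_le).trans hδ1
      have hqδ : q + δ / 2 = 1 := tsub_add_cancel_of_le hδ2
      have hq1 : q ≤ 1 := tsub_le_self
      have hqk1 : q ^ k ≤ 1 := pow_le_one₀ bot_le hq1
      have hq0 : 0 < q := by
        rw [hq, tsub_pos_iff_lt]
        exact (half_lt_self hδ0).trans_le hδ1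
      have hε1 : δ / 2 * q ^ k ≤ 1 := mul_le_one₀ hδ2 bot_le hqk1
      refine (ih.improve hS (α' := q ^ k) (δ' := 1 - δ) (ε := δ / 2 * q ^ k)
        (ε' := 1 - δ / 2 * q ^ k) (tsub_add_cancel_of_le hqk1) (add_tsub_cancel_of_le hδ1)
        (add_tsub_cancel_of_le hε1) (by positivity)).of_le ?_
      rw [← NNReal.coe_le_coe] at hqk1 hε1 hδ1 ⊢
      have hqk : q ^ (k + 1) ≤ 1 := pow_le_one₀ bot_le hq1
      have hqδ' : (q : ℝ) = 1 - δ / 2 := by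
        have := congrArg NNReal.toReal hqδ
        push_cast at this
        linarith
      rw [NNReal.coe_sub hqk, NNReal.coe_mul, NNReal.coe_sub (by exact_mod_cast hε1),
        NNReal.coe_add, NNReal.coe_sub (by exact_mod_cast hqk1)]
      push_cast at hqk1 hε1 hδ1 ⊢
      have hδ' : (Fintype.card ι : ℝ)⁻¹ = δ := by
        rw [hδdef]
        push_cast
        rfl
      rw [pow_succ, hqδ', hδ']
      have hx : (0 : ℝ) ≤ q ^ k := by positivity
      rw [hqδ'] at hx hqk1
      have hd : (0 : ℝ) ≤ δ := δ.2
      generalize ((1 : ℝ) - δ / 2) ^ k = x at *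
      nlinarith [mul_nonneg hd hx, mul_nonneg (mul_nonneg hd hx) (mul_nonneg hx (sub_nonneg.mpr hδ1))]
  obtain ⟨k, hk⟩ := exists_pow_lt_of_lt_one (tsub_pos_of_lt hα)
    (show 1 - δ / 2 < 1 from tsub_lt_self one_pos (half_pos hδ0))
  refine (key k).of_le ?_
  refine le_tsub_of_add_le_right ?_
  calc α + (1 - δ / 2) ^ k ≤ α + (1 - α) := add_le_add le_rfl hk.le
    _ = 1 := add_tsub_cancel_of_le hα.le

/-- Each `f i` is the supremum of `(k + 1) / (k + 2)` times an approximating sequence; finiteness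
allows a common `k`. -/
theorem WayBelow.exists_smul (hS : CuAxioms S) {ι : Type*} [Finite ι]
    {f' f : ι → CuFunctional S → ℝ≥0∞} (hf : ∀ i, f i ∈ CuRealification S)
    (h : ∀ i, WayBelow (f' i) (f i)) :
    ∃ c : ℝ≥0, c < 1 ∧ ∃ x : ι → CuFunctional S → ℝ≥0∞, (∀ i, x i ∈ CuRealification S) ∧
      (∀ i, WayBelow (x i) (f i)) ∧ ∀ i, f' i ≤ c • x i := by
  choose y hy hym _ hyf hys using fun i => exists_seq hS (hf i)
  have hcoe : ∀ k : ℕ, ((((k + 1 : ℕ) : ℝ≥0) / ((k + 2 : ℕ) : ℝ≥0) : ℝ≥0) : ℝ≥0∞)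
      = ((k + 1 : ℕ) : ℝ≥0∞) / ((k + 2 : ℕ) : ℝ≥0∞) := fun k => by
    rw [ENNReal.coe_div (by exact_mod_cast (by omega : k + 2 ≠ 0)), ENNReal.coe_natCast,
      ENNReal.coe_natCast]
  have hmono : ∀ i, Monotone fun k : ℕ => (((k + 1 : ℕ) : ℝ≥0) / ((k + 2 : ℕ) : ℝ≥0)) • y i k := by
    intro i j k hjk
    refine (smul_mono_right _ (hym i hjk)).trans (smul_mono_left ?_ _)
    rw [← ENNReal.coe_le_coe, hcoe, hcoe]
    exact monotone_natCast_div_add_one hjk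
  have hex : ∀ i, ∃ k : ℕ, f' i ≤ (((k + 1 : ℕ) : ℝ≥0) / ((k + 2 : ℕ) : ℝ≥0)) • y i k := by
    intro i
    refine h i _ (fun k => smul_mem hS _ (hy i k)) (hmono i) ?_
    intro φ
    conv_lhs => rw [hys i]
    simp only [iSup_apply, smul_apply, hcoe]
    exact (iSup_natCast_div_mul fun j k hjk => hym i hjk φ).ge
  choose k hk using hex
  obtain ⟨K, hK⟩ := Finite.exists_le k
  refine ⟨((K + 1 : ℕ) : ℝ≥0) / ((K + 2 : ℕ) : ℝ≥0), ?_, fun i => y i K, fun i => hy i K,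
    fun i => hyf i K, fun i => (hk i).trans (hmono i (hK i))⟩
  rw [div_lt_one (by exact_mod_cast (by omega : 0 < K + 2))]
  exact_mod_cast Nat.lt_succ_self _

/-- Riesz decomposition in the realification, for one function. -/
theorem WayBelow.exists_decomposition (hS : CuAxioms S) {ι : Type*} [Fintype ι]
    {f' f : CuFunctional S → ℝ≥0∞} {g : ι → CuFunctional S → ℝ≥0∞} (hf : f ∈ CuRealification S)
    (hg : ∀ j, g j ∈ CuRealification S) (hff : WayBelow f' f) (hfg : f ≤ ∑ j, g j) :
    ∃ h : ι → CuFunctional S → ℝ≥0∞, (∀ j, h j ∈ CuRealification S) ∧ (∀ j, h j ≤ g j) ∧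
      ∑ j, h j ≤ f ∧ f' ≤ ∑ j, h j := by
  rcases isEmpty_or_nonempty ι with hι | hι
  · refine ⟨fun _ => 0, fun _ => zero_mem _, fun _ _ => bot_le, ?_, ?_⟩
    · rw [Finset.sum_const_zero]
      exact fun _ => bot_le
    · rw [Finset.univ_eq_empty, Finset.sum_empty] at hfg ⊢
      exact (hff.le hf).trans hfg
  · obtain ⟨c, hc, x, -, hxf, hfx⟩ := WayBelow.exists_smul hS (ι := Unit) (f' := fun _ => f')
      (f := fun _ => f) (fun _ => hf) (fun _ => hff)
    obtain ⟨h, h1, h2, h3, h4⟩ := hasDecomposition hS ι hc (x ()) f g hf hg (hxf ()) hfg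
    exact ⟨h, h1, h2, h3, (hfx ()).trans h4⟩

/-- Riesz decomposition in the realification. -/
theorem exists_refinement (hS : CuAxioms S) (n : ℕ) : ∀ {ι : Type} [Fintype ι]
    {f' f : Fin n → CuFunctional S → ℝ≥0∞} {g : ι → CuFunctional S → ℝ≥0∞},
    (∀ i, f i ∈ CuRealification S) → (∀ j, g j ∈ CuRealification S) →
    (∀ i, WayBelow (f' i) (f i)) → ∑ i, f i ≤ ∑ j, g j →
    ∃ h : Fin n → ι → CuFunctional S → ℝ≥0∞, (∀ i j, h i j ∈ CuRealification S) ∧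
      (∀ i, f' i ≤ ∑ j, h i j) ∧ (∀ i, ∑ j, h i j ≤ f i) ∧ ∀ j, ∑ i, h i j ≤ g j := by
  induction n with
  | zero =>
    intro ι _ f' f g hf hg hff hfg
    exact ⟨fun i => i.elim0, fun i => i.elim0, fun i => i.elim0, fun i => i.elim0, fun j => by
      rw [Finset.univ_eq_empty, Finset.sum_empty]; exact fun _ => bot_le⟩
  | succ n ih =>
    intro ι _ f' f g hf hg hff hfg
    obtain ⟨c, hc, x, hx, hxf, hfx⟩ := WayBelow.exists_smul hS hf hff
    obtain ⟨N, hN, hcN⟩ : ∃ N : ℕ, 0 < N ∧ c * (1 + (N : ℝ≥0)⁻¹) ≤ 1 := by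
      obtain ⟨M, hM⟩ := exists_nat_gt ((1 - c)⁻¹)
      have hc0 : 0 < 1 - c := tsub_pos_of_lt hc
      have hM0 : 0 < (M : ℝ≥0) := (inv_pos.mpr hc0).trans hM
      refine ⟨M, by exact_mod_cast hM0, ?_⟩
      have h1 : (M : ℝ≥0)⁻¹ ≤ 1 - c := by
        have := inv_anti₀ (inv_pos.mpr hc0) hM.le
        rwa [inv_inv] at this
      calc c * (1 + (M : ℝ≥0)⁻¹) = c + c * (M : ℝ≥0)⁻¹ := by ring
        _ ≤ c + 1 * (1 - c) := by gcongr
        _ = 1 := by rw [one_mul, add_tsub_cancel_of_le hc.le]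
    set η : ℝ≥0 := (N : ℝ≥0)⁻¹ with hη
    choose f₁ hf₁ hxf₁ hf₁f using fun i => (hxf i).interpolate hS (hf i)
    obtain ⟨g', hg', hgg, hfg'⟩ := ((WayBelow.sum hS Finset.univ hf hf₁f).mono le_rfl
      hfg).exists_sum hS Finset.univ hg
    have hsplit : f₁ 0 + ∑ i : Fin n, f₁ i.succ ≤ ∑ j, g' j := by
      rwa [← Fin.sum_univ_succ]
    obtain ⟨f₂, hf₂, hxf₂, hf₂₁⟩ := (hxf₁ 0).interpolate hS (hf₁ 0)
    obtain ⟨h, hh, hhg, hhf, hfh⟩ := hf₂₁.exists_decomposition hS (hf₁ 0) hg'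
      (le_trans (fun _ => le_self_add) hsplit)
    obtain ⟨h', -, hhh, hxh'⟩ := (hxf₂.mono le_rfl hfh).exists_sum hS Finset.univ hh
    obtain ⟨a, b, k, ha, hb, hk, hha, hab, hbh, hgap, hak, hbk⟩ := exists_complement hS hh hg hhh
      hgg (fun j => (hhg j).trans ((hgg j).le (hg j))) hN
    have hah : ∀ j, a j ≤ h j := fun j => ((hab j).le (hb j)).trans (hbh j)
    have hasum : ∑ j, a j ≤ f₁ 0 := (Finset.sum_le_sum fun j _ => hah j).trans hhf
    have hrest := le_smul_sum_add_sum hN hah hgap hbk ((add_le_add hasum le_rfl).trans hsplit)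
    -- The errors `η • h j` enter as additional summands, to be merged with the remainders `k j` of
    -- the same index.
    obtain ⟨H, hH, hxH, hHf, hHg⟩ := ih (ι := ι ⊕ ι) (f' := fun i => x i.succ)
      (f := fun i => f₁ i.succ) (g := Sum.elim (fun j => η • h j) k) (fun i => hf₁ _)
      (fun j => by
        cases j with
        | inl j => exact smul_mem hS _ (hh j)
        | inr j => exact hk j)
      (fun i => hxf₁ _) (by
        rw [Fintype.sum_sum_type]
        simpa only [Sum.elim_inl, Sum.elim_inr, ← Finset.smul_sum] using hrest)
    -- Merging overshoots to `(1 + η) • g j`. Scaling by `θ` corrects this, and `c ≤ θ` keeps the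
    -- lower bounds.
    set θ : ℝ≥0 := (1 + η)⁻¹ with hθ
    have hη0 : 1 + η ≠ 0 := by positivity
    have hθ1 : θ ≤ 1 := inv_le_one_of_one_le₀ le_self_add
    have hcθ : c ≤ θ := by
      rwa [hθ, NNReal.le_inv_iff_mul_le hη0]
    have hle : ∀ y : CuFunctional S → ℝ≥0∞, θ • y ≤ y := fun y => by
      simpa only [one_smul] using smul_mono_left hθ1 y
    refine ⟨Fin.cons (fun j => θ • a j) fun i j => θ • (H i (Sum.inl j) + H i (Sum.inr j)),
      fun i j => ?_, fun i => ?_, fun i => ?_, fun j => ?_⟩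
    · refine Fin.cases ?_ (fun i => ?_) i
      · exact smul_mem hS _ (ha j)
      · exact smul_mem hS _ (add_mem (hH _ _) (hH _ _))
    · refine (hfx i).trans ((smul_mono_left hcθ _).trans ?_)
      refine Fin.cases ?_ (fun i => ?_) i
      · simp only [Fin.cons_zero, ← Finset.smul_sum]
        exact smul_mono_right _ (hxh'.trans (Finset.sum_le_sum fun j _ => hha j))
      · simp only [Fin.cons_succ, ← Finset.smul_sum]
        refine smul_mono_right _ ((hxH i).trans_eq ?_)
        rw [Fintype.sum_sum_type, Finset.sum_add_distrib]
    · refine Fin.cases ?_ (fun i => ?_) i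
      · simp only [Fin.cons_zero, ← Finset.smul_sum]
        exact (hle _).trans (hasum.trans ((hf₁f 0).le (hf 0)))
      · simp only [Fin.cons_succ, ← Finset.smul_sum]
        refine (hle _).trans (le_trans (le_of_eq ?_) ((hHf i).trans ((hf₁f _).le (hf _))))
        rw [Fintype.sum_sum_type, Finset.sum_add_distrib]
    · rw [Fin.sum_univ_succ]
      simp only [Fin.cons_zero, Fin.cons_succ, ← Finset.smul_sum, Finset.sum_add_distrib]
      rw [← smul_add]
      calc θ • (a j + (∑ i, H i (Sum.inl j) + ∑ i, H i (Sum.inr j)))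
          ≤ θ • (a j + (η • h j + k j)) :=
            smul_mono_right _ (add_le_add le_rfl (add_le_add (hHg (Sum.inl j)) (hHg (Sum.inr j))))
        _ = θ • ((a j + k j) + η • h j) := by congr 1; abel
        _ ≤ θ • (g j + η • g j) := smul_mono_right _ (add_le_add (hak j)
            (smul_mono_right _ ((hhg j).trans ((hgg j).le (hg j)))))
        _ = g j := by
            conv_lhs => rw [← one_smul ℝ≥0 (g j), smul_smul, mul_one, ← add_smul, smul_smul, hθ,
              inv_mul_cancel₀ hη0, one_smul]

end Refinement

end CuRealification

theorem theorem4p1 {S : Type*} [AddCommMonoid S] [PartialOrder S] [IsOrderedAddMonoid S]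
    (hS : CuAxioms S) (n m : ℕ)
    (f f' : Fin n → CuRealification S) (g : Fin m → CuRealification S)
    (hfg : ∑ i, f i ≤ ∑ j, g j)
    (hf' : ∀ i, CompactlyContained (f' i) (f i)) :
    ∃ h : Fin n → Fin m → CuRealification S,
      (∀ i, CompactlyContained (f' i) (∑ j, h i j) ∧
        CompactlyContained (∑ j, h i j) (f i)) ∧
      ∀ j, ∑ i, h i j ≤ g j := by
  have hw := fun i => (CuRealification.compactlyContained_iff hS _ _).mp (hf' i)
  have hsum : ∑ i, (f i : CuFunctional S → ℝ≥0∞) ≤ ∑ j, (g j : CuFunctional S → ℝ≥0∞) := by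
    have h : ((∑ i, f i : CuRealification S) : CuFunctional S → ℝ≥0∞)
        ≤ ((∑ j, g j : CuRealification S) : CuFunctional S → ℝ≥0∞) := hfg
    rwa [AddSubmonoid.coe_finsetSum, AddSubmonoid.coe_finsetSum] at h
  -- Refining `x i ≪ y i` strictly between `f' i` and `f i` turns the inequalities of
  -- `exists_refinement` into compact containments.
  choose y hy hfy hyf using fun i => (hw i).interpolate hS (f i).2
  choose x hx hfx hxy using fun i => (hfy i).interpolate hS (hy i)
  obtain ⟨h, hh, h1, h2, h3⟩ := CuRealification.exists_refinement hS n hy (fun j => (g j).2) hxy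
    ((Finset.sum_le_sum fun i _ => (hyf i).le (f i).2).trans hsum)
  refine ⟨fun i j => ⟨h i j, hh i j⟩, fun i => ⟨?_, ?_⟩, fun j => ?_⟩
  · rw [CuRealification.compactlyContained_iff hS, AddSubmonoid.coe_finsetSum]
    exact (hfx i).mono le_rfl (h1 i)
  · rw [CuRealification.compactlyContained_iff hS, AddSubmonoid.coe_finsetSum]
    exact (hyf i).mono (h2 i) le_rfl
  · rw [← Subtype.coe_le_coe, AddSubmonoid.coe_finsetSum]
    exact h3 j
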